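/- Let $\Phi$ be of type $G_2$, $F_4$, $E_6$, $E_7$ or $E_8$, with base $\Delta$ and Coxeter number $h$ ($=6,12,12,18,30$ respectively). Let $k$ be a field whose characteristic $\ell$ is $0$ or a prime. Let $\mathfrak g$ be a Lie algebra over $k$ of type $\Phi$ with a Chevalley basis: coroot vectors $H_\alpha$ ($\alpha\in\Delta$), spanning the Cartan subalgebra $\mathfrak t$, and root vectors $X_\alpha\in\mathfrak g_\alpha$ ($\alpha\in\Phi$), with $[X_\alpha,X_{-\alpha}]=H_\alpha$ and, if $\alpha+\beta$ is a root, $[X_\alpha,X_\beta]=\pm(r+1)X_{\alpha+\beta}$, where $r$ is the largest integer such that $\beta-r\alpha$ is a root. Write $2\rho^\vee=\sum_{\alpha>0}\alpha^\vee=\sum_{\alpha\in\Delta}c_\alpha\alpha^\vee$ and put $$X=\sum_{\alpha\in\Delta}X_\alpha,\qquad H=\sum_{\alpha\in\Delta}c_\alpha H_\alpha,\qquad Y=\sum_{\alpha\in\Delta}c_\alpha X_{-\alpha}.$$ Let $\varphi\colon\mathfrak{sl}_2\to\mathfrak g$ be the principal homomorphism, which sends the standard basis $e,h,f$ to $X,H,Y$;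 it makes $\mathfrak g$ an $\mathfrak{sl}_2$-module. The exponents of $\mathfrak g$ are $1,5$ for $G_2$; $1,5,7,11$ for $F_4$; $1,4,5,7,8,11$ for $E_6$; $1,5,7,9,11,13,17$ for $E_7$; $1,7,11,13,17,19,23,29$ for $E_8$. For an exponent $m$ let $P_{2m}=\{p\in\mathfrak g: [X,p]=0,\ [H,p]=2mp\}$, let $V_m$ be the $\mathfrak{sl}_2$-submodule of $\mathfrak g$ generated by $P_{2m}$, and put $L_m=V_m\cap\bigoplus_{\alpha\in\Delta}\mathfrak g_{-\alpha}$. For $\alpha\in\Delta$ let $\mathfrak l_\alpha=kH_\alpha$. (In the cases in which it is used below, $\mathfrak t=\ker\alpha\oplus\mathfrak l_\alpha$.) The list of excluded primes is - $G_2$: $\{2,3,5\}$; - $F_4$ and $E_6$: $\{2,3,5,7,11\}$; - $E_7$: $\{2,3,5,7,11,13,17,19,31,37,53\}$; - $E_8$: $\{2,3,5,7,11,13,17,19,23,29,61,67,71,97,103,109,229,269,397\}$. Then: 1. If $\ell=0$ or $\ell\ge 2h-1$, then for every exponent $m$ the submodule $V_m$ is a direct summand of the $\mathfrak{sl}_2$-module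 $\mathfrak g$, is isomorphic to $\mathrm{Sym}^{2m}(k^2)$, and is the only submodule of $\mathfrak g$ that is isomorphic to $\mathrm{Sym}^{2m}(k^2)$. 2. If $\ell=0$ or $\ell\ge h$ (in particular if $\ell$ is not in the list), then for every exponent $m$ both $P_{2m}$ and $L_m$ are one-dimensional. 3. In types $G_2,F_4,E_7,E_8$, if $\ell$ is not in the list, then for every exponent $m$ and every $\alpha\in\Delta$ the projection of the line $L_m$ to $\mathfrak g_{-\alpha}$ is nonzero. Conversely, in every type, if $\ell\ge h$ is in the list, then there are an exponent $m$ and an $\alpha\in\Delta$ for which this projection is zero. 4. In type $E_6$, suppose that $\ell$ is not in the list. If $m\ne 4,8$ is an exponent, then the projection of $L_m$ to $\mathfrak g_{-\alpha}$ is nonzero for every $\alpha\in\Delta$. There are simple roots that are not fixed by the nontrivial automorphism of the Dynkin diagram, and for every such simple root $\alpha_1$: the projections of $L_4$ and of $L_8$ to $\mathfrak g_{-\alpha_1}$ are nonzero, and for every exponent $n$ the projection of $\mathfrak t\cap V_n$ to $\mathfrak l_{\alpha_1}$ is nonzero. -/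

import Mathlib

noncomputable section

/-! ### Root systems and Chevalley bases

Throughout, `A i j = ⟨α_i, α_j^∨⟩` is a Cartan matrix.  Roots are written in the basis of simple
roots, coroots in the basis of simple coroots. -/

/-- `⟨v, α_i^∨⟩` for `v = ∑ v_j α_j`. -/
def pairSimpleCoroot {n : ℕ} (A : Matrix (Fin n) (Fin n) ℤ) (v : Fin n → ℤ) (i : Fin n) : ℤ :=
  ∑ j, v j * A j i

/-- `⟨α_i, w⟩` for `w = ∑ w_j α_j^∨`. -/
def pairSimpleRoot {n : ℕ} (A : Matrix (Fin n) (Fin n) ℤ) (i : Fin n) (w : Fin n → ℤ) : ℤ :=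
  ∑ j, A i j * w j

/-- The set of pairs `(α, α^∨)`: the smallest set that contains the pairs of a simple root and its
coroot and is stable under negation and under the simple reflections. -/
inductive IsRootPair {n : ℕ} (A : Matrix (Fin n) (Fin n) ℤ) : (Fin n → ℤ) → (Fin n → ℤ) → Prop
  | simple (i : Fin n) : IsRootPair A (Pi.single i 1) (Pi.single i 1)
  | neg {v w : Fin n → ℤ} : IsRootPair A v w → IsRootPair A (-v) (-w)
  | reflect (i : Fin n) {v w : Fin n → ℤ} : IsRootPair A v w →
      IsRootPair A (v - pairSimpleCoroot A v i • Pi.single i 1)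
        (w - pairSimpleRoot A i w • Pi.single i 1)

/-- A root, together with its coroot. -/
structure Root {n : ℕ} (A : Matrix (Fin n) (Fin n) ℤ) where
  root : Fin n → ℤ
  coroot : Fin n → ℤ
  isRootPair : IsRootPair A root coroot

/-- The simple root `α_i`. -/
def simpleRoot {n : ℕ} (A : Matrix (Fin n) (Fin n) ℤ) (i : Fin n) : Root A :=
  ⟨_, _, .simple i⟩

/-- The root `-α_i`. -/
def negSimpleRoot {n : ℕ} (A : Matrix (Fin n) (Fin n) ℤ) (i : Fin n) : Root A :=
  ⟨_, _, .neg (.simple i)⟩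

/-- The coefficient `c_i` of `α_i^∨` in the sum `2ρ^∨` of all positive coroots. -/
def twoRhoCheck {n : ℕ} (A : Matrix (Fin n) (Fin n) ℤ) (i : Fin n) : ℤ :=
  ∑ᶠ (α : Root A) (_ : 0 ≤ α.root), α.coroot i

/-- A Chevalley basis `{h_i} ∪ {x_α}` of the Lie algebra `g` over `k`, with Cartan matrix `A`:
`h_i` is the simple coroot vector, and `[x_α, x_β] = ± (r + 1) x_{α + β}` where `r` is the largest
natural number such that `β - r α` is a root. -/
structure ChevalleyBasis {n : ℕ} (A : Matrix (Fin n) (Fin n) ℤ) (k g : Type*) [Field k]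
    [LieRing g] [LieAlgebra k g] where
  basis : Module.Basis (Fin n ⊕ Root A) k g
  lie_h_h : ∀ i j, ⁅basis (.inl i), basis (.inl j)⁆ = 0
  lie_h_x : ∀ (i : Fin n) (α : Root A),
    ⁅basis (.inl i), basis (.inr α)⁆ = pairSimpleCoroot A α.root i • basis (.inr α)
  lie_x_neg : ∀ α β : Root A, α.root + β.root = 0 →
    ⁅basis (.inr α), basis (.inr β)⁆ = ∑ i, α.coroot i • basis (.inl i)
  lie_x_x : ∀ α β γ : Root A, α.root + β.root = γ.root →
    ∀ r : ℕ, IsGreatest {q : ℕ | ∃ δ : Root A, δ.root = β.root - q • α.root} r →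
      ⁅basis (.inr α), basis (.inr β)⁆ = (r + 1) • basis (.inr γ) ∨
      ⁅basis (.inr α), basis (.inr β)⁆ = -((r + 1) • basis (.inr γ))
  lie_x_x_zero : ∀ α β : Root A, α.root + β.root ≠ 0 →
    (∀ γ : Root A, γ.root ≠ α.root + β.root) → ⁅basis (.inr α), basis (.inr β)⁆ = 0

/-! ### The modules `Sym^d(k²)` of `sl₂` -/

theorem isHomogeneous_symAction {k : Type*} [Field k] {d : ℕ} (M : Matrix (Fin 2) (Fin 2) k)
    {q : MvPolynomial (Fin 2) k} (hq : q.IsHomogeneous d) :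
    (∑ i, ∑ j, MvPolynomial.C (M i j) * (MvPolynomial.X i * MvPolynomial.pderiv j q)).IsHomogeneous
      d := by
  refine MvPolynomial.IsHomogeneous.sum _ _ _ fun i _ => MvPolynomial.IsHomogeneous.sum _ _ _
    fun j _ => MvPolynomial.IsHomogeneous.C_mul ?_ _
  rcases Nat.eq_zero_or_pos d with rfl | hd
  · have h : q = MvPolynomial.C (MvPolynomial.coeff 0 q) :=
      MvPolynomial.totalDegree_eq_zero_iff_eq_C.mp
        (Nat.le_zero.mp hq.totalDegree_le)
    rw [h, MvPolynomial.pderiv_C, mul_zero]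
    exact MvPolynomial.isHomogeneous_zero _ _ _
  · have h := (MvPolynomial.isHomogeneous_X k i).mul (hq.pderiv (i := j))
    rwa [show 1 + (d - 1) = d by omega] at h

/-- The action of a `2 × 2` matrix on `Sym^d(k²)`, the space of binary forms of degree `d`, by the
derivation that extends its action `x_j ↦ ∑ M_ij x_i` on `k²`. -/
def symAction {k : Type*} [Field k] (d : ℕ) (M : Matrix (Fin 2) (Fin 2) k)
    (q : MvPolynomial.homogeneousSubmodule (Fin 2) k d) :
    MvPolynomial.homogeneousSubmodule (Fin 2) k d :=
  ⟨∑ i, ∑ j, MvPolynomial.C (M i j) *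
      (MvPolynomial.X i * MvPolynomial.pderiv j (q : MvPolynomial (Fin 2) k)),
    isHomogeneous_symAction M q.2⟩

/-- The subspace `V` of `g` is stable under `sl₂`, acting through `φ` and the adjoint action. -/
def IsSl2Stable {k g : Type*} [Field k] [LieRing g] [LieAlgebra k g]
    (φ : LieAlgebra.SpecialLinear.sl (Fin 2) k →ₗ⁅k⁆ g) (V : Submodule k g) : Prop :=
  ∀ s, ∀ v ∈ V, ⁅φ s, v⁆ ∈ V

/-- `V` is an `sl₂`-submodule of `g` that is isomorphic to `Sym^d(k²)`. -/
def IsSymPower {k g : Type*} [Field k] [LieRing g] [LieAlgebra k g]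
    (φ : LieAlgebra.SpecialLinear.sl (Fin 2) k →ₗ⁅k⁆ g) (d : ℕ) (V : Submodule k g) : Prop :=
  IsSl2Stable φ V ∧
  ∃ Φ : MvPolynomial.homogeneousSubmodule (Fin 2) k d ≃ₗ[k] V,
    ∀ (s : LieAlgebra.SpecialLinear.sl (Fin 2) k) q,
      (Φ (symAction d s.1 q) : g) = ⁅φ s, (Φ q : g)⁆

/-! ### The principal `sl₂` -/

namespace ChevalleyBasis

variable {n : ℕ} {A : Matrix (Fin n) (Fin n) ℤ} {k g : Type*} [Field k] [LieRing g]
  [LieAlgebra k g]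

/-- `X = ∑ X_α` over the simple roots `α`. -/
def principalX (B : ChevalleyBasis A k g) : g := ∑ i, B.basis (.inr (simpleRoot A i))

/-- `H = ∑ c_α H_α = 2ρ^∨`. -/
def principalH (B : ChevalleyBasis A k g) : g := ∑ i, twoRhoCheck A i • B.basis (.inl i)

/-- `Y = ∑ c_α Y_α` over the simple roots `α`. -/
def principalY (B : ChevalleyBasis A k g) : g :=
  ∑ i, twoRhoCheck A i • B.basis (.inr (negSimpleRoot A i))

/-- `φ` is the principal homomorphism: it sends the standard basis `e, h, f` of `sl₂` to
`X, H, Y`. -/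
def IsPrincipal (B : ChevalleyBasis A k g)
    (φ : LieAlgebra.SpecialLinear.sl (Fin 2) k →ₗ⁅k⁆ g) : Prop :=
  ∀ s, φ s = s.1 0 1 • B.principalX + s.1 0 0 • B.principalH + s.1 1 0 • B.principalY

/-- `P_{2m}`: the `2m`-eigenspace of `ad H` in the centralizer of `X`. -/
def centralizerEigenspace (B : ChevalleyBasis A k g) (m : ℕ) : Submodule k g where
  carrier := {p | ⁅B.principalX, p⁆ = 0 ∧ ⁅B.principalH, p⁆ = (2 * (m : k)) • p}
  add_mem' := by
    rintro a b ⟨h1, h2⟩ ⟨h3, h4⟩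
    exact ⟨by rw [lie_add, h1, h3, add_zero], by rw [lie_add, h2, h4, smul_add]⟩
  zero_mem' := ⟨lie_zero _, by rw [lie_zero, smul_zero]⟩
  smul_mem' := by
    rintro c a ⟨h1, h2⟩
    exact ⟨by rw [lie_smul, h1, smul_zero], by rw [lie_smul, h2, smul_comm]⟩

/-- `V_m`: the `sl₂`-submodule of `g` generated by `P_{2m}`. -/
def summand (B : ChevalleyBasis A k g) (φ : LieAlgebra.SpecialLinear.sl (Fin 2) k →ₗ⁅k⁆ g)
    (m : ℕ) : Submodule k g :=
  sInf {V | IsSl2Stable φ V ∧ B.centralizerEigenspace m ≤ V}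

/-- The sum of the root spaces `g_{-α}` over the simple roots `α`. -/
def negSimpleSpace (B : ChevalleyBasis A k g) : Submodule k g :=
  Submodule.span k (Set.range fun i => B.basis (.inr (negSimpleRoot A i)))

/-- The Cartan subalgebra `t`. -/
def cartanSpace (B : ChevalleyBasis A k g) : Submodule k g :=
  Submodule.span k (Set.range fun i => B.basis (.inl i))

/-- `V` has nonzero projection to the root space `g_{-α_i}`. -/
def ProjNegRootNonzero (B : ChevalleyBasis A k g) (V : Submodule k g) (i : Fin n) : Prop :=
  ∃ v ∈ V, B.basis.repr v (.inr (negSimpleRoot A i)) ≠ 0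

/-- `V ⊆ t` has nonzero projection to the line `l_α` spanned by the coroot vector of `α = α_i`, with
respect to the decomposition `t = ker α ⊕ l_α`. -/
def ProjCorootNonzero (B : ChevalleyBasis A k g) (V : Submodule k g) (i : Fin n) : Prop :=
  ∃ v ∈ V, ∃ w ∈ B.cartanSpace, ∃ c : k, ⁅w, B.basis (.inr (simpleRoot A i))⁆ = 0 ∧ c ≠ 0 ∧
    v = w + c • B.basis (.inl i)

end ChevalleyBasis

/-! ### The exceptional types -/

inductive ExceptionalType
  | G₂ | F₄ | E₆ | E₇ | E₈

namespace ExceptionalType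

def rank : ExceptionalType → ℕ
  | G₂ => 2 | F₄ => 4 | E₆ => 6 | E₇ => 7 | E₈ => 8

def cartan : (t : ExceptionalType) → Matrix (Fin t.rank) (Fin t.rank) ℤ
  | G₂ => CartanMatrix.G₂
  | F₄ => CartanMatrix.F₄
  | E₆ => CartanMatrix.E₆
  | E₇ => CartanMatrix.E₇
  | E₈ => CartanMatrix.E₈

def exponents : ExceptionalType → Finset ℕ
  | G₂ => {1, 5}
  | F₄ => {1, 5, 7, 11}
  | E₆ => {1, 4, 5, 7, 8, 11}
  | E₇ => {1, 5, 7, 9, 11, 13, 17}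
  | E₈ => {1, 7, 11, 13, 17, 19, 23, 29}

def coxeterNumber : ExceptionalType → ℕ
  | G₂ => 6 | F₄ => 12 | E₆ => 12 | E₇ => 18 | E₈ => 30

/-- The list of excluded primes. -/
def badPrimes : ExceptionalType → Finset ℕ
  | G₂ => {2, 3, 5}
  | F₄ => {2, 3, 5, 7, 11}
  | E₆ => {2, 3, 5, 7, 11}
  | E₇ => {2, 3, 5, 7, 11, 13, 17, 19, 31, 37, 53}
  | E₈ => {2, 3, 5, 7, 11, 13, 17, 19, 23, 29, 61, 67, 71, 97, 103, 109, 229, 269, 397}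

/-- The simple root `α_i` is not fixed by some automorphism of the Dynkin diagram. -/
def IsMoved (t : ExceptionalType) (i : Fin t.rank) : Prop :=
  ∃ σ : Equiv.Perm (Fin t.rank), (∀ a b, t.cartan (σ a) (σ b) = t.cartan a b) ∧ σ i ≠ i

end ExceptionalType

end

/-! Grade `g` by height: `t` is the part of degree 0, and `e = ad X`, `f = ad Y` have degrees 1 and
-1. In the coordinates given by the simple coroots, both `f e` and `e f` act on `t` by the matrix `N
= (c_i A_ij)`. Over `ℚ` its eigenvalues are `m (m + 1)` for the exponents `m`, with explicit
integral eigenvectors `U m`. Everything about the modules `V_m` is read off from `N`.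

On `t` one has `f^i e^i = ∏_{a < i} (N - a (a + 1))`. If `ℓ = 0` or `ℓ ≥ h`, the factors with `a`
not an exponent do not enlarge the kernel, and each exponent adds at most one dimension, because an
eigenvector of `N` is determined by its coordinate at one end node. So the rank of `f^i e^i` is at
least the number of exponents `≥ i`, which bounds the number of roots of height `i` from above.
Hence `e^i` maps `t` onto degree `i`, `f^i` is injective on degree `i`, and the dimensions agree
(`IsGradedPair.surjective_and_injective`). The same holds with `e` and `f` exchanged.

It follows that `P_{2m}` is a line, spanned by some `p` of degree `m`. The vector `f^m p` is nonzero
in `t` and an eigenvector of `N` for `m (m + 1)`, so it is a multiple of `U m`, and `f^{m+1} p` has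
the same coordinates up to a nonzero scalar in the basis `X_{-α}`. The projection of `L_m` to
`g_{-α_i}` is therefore zero exactly when `ℓ` divides `U m i`, and the lists of primes are checked
on the integers `U m i`.

If `ℓ = 0` or `ℓ ≥ 2h - 1`, the eigenvalues stay distinct in `k`. The Casimir operator commutes with
`sl₂` and is carried to `N` by the powers of `e` and `f`, so `V_m` is its eigenspace for `m (m + 1)`
and the other eigenvalues give a complement. Sending `x^a y^b` to a multiple of `f^b p` identifies
`Sym^{2m}` with `V_m`. Any submodule isomorphic to it contains `P_{2m}`, hence `V_m`, and has the
same dimension. -/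

section

open Polynomial

/-- Endomorphisms `e`, `f` of degrees `1` and `-1` of a graded vector space, such that `[e, f]` acts
on the part of degree `j` as multiplication by `2 j`. -/
structure IsGradedPair {k V : Type*} [Field k] [AddCommGroup V] [Module k V]
    (G : ℤ → Submodule k V) (e f : Module.End k V) : Prop where
  e_mem : ∀ {j v}, v ∈ G j → e v ∈ G (j + 1)
  f_mem : ∀ {j v}, v ∈ G j → f v ∈ G (j - 1)
  comm : ∀ {j v}, v ∈ G j → e (f v) = f (e v) + (2 * (j : k)) • v

/-- The polynomial `∏ (x - a (a + 1))`. -/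
noncomputable def casimirPoly (k : Type*) [Field k] (S : Finset ℕ) : k[X] :=
  ∏ a ∈ S, (X - C ((a : k) * (a + 1)))

/-! ### Kernels of products of linear factors in one endomorphism -/

section LinearAlgebra

variable {k W : Type*} [Field k] [AddCommGroup W] [Module k W]

theorem aeval_X_sub_C_apply (N : Module.End k W) (r : k) (u : W) :
    aeval N (X - C r) u = N u - r • u := by
  simp

theorem finrank_ker_mul_le [FiniteDimensional k W] (f g : Module.End k W) :
    Module.finrank k (LinearMap.ker (f * g)) ≤
      Module.finrank k (LinearMap.ker f) + Module.finrank k (LinearMap.ker g) := by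
  have h1 := LinearMap.finrank_range_add_finrank_ker (g.domRestrict (LinearMap.ker (f * g)))
  have h2 : LinearMap.range (g.domRestrict (LinearMap.ker (f * g))) ≤ LinearMap.ker f := by
    rintro _ ⟨⟨x, hx⟩, rfl⟩
    simpa using hx
  have h3 : Module.finrank k (LinearMap.ker (g.domRestrict (LinearMap.ker (f * g)))) ≤
      Module.finrank k (LinearMap.ker g) := by
    let φ : LinearMap.ker (g.domRestrict (LinearMap.ker (f * g))) →ₗ[k] LinearMap.ker g :=
      LinearMap.codRestrict _ ((Submodule.subtype _).comp (Submodule.subtype _))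
        (fun x => LinearMap.mem_ker.mp x.2)
    refine LinearMap.finrank_le_finrank_of_injective (f := φ) ?_
    intro x y hxy
    have := congrArg Subtype.val hxy
    exact Subtype.ext (Subtype.ext this)
  have h4 := Submodule.finrank_mono h2
  omega

/-- Kernel dimension is subadditive over factors, so the values `a (a + 1)` need not be distinct in
`k`. This matters for `h ≤ ℓ < 2h - 1`, where two exponents may give the same eigenvalue. -/
theorem finrank_ker_aeval_casimirPoly_le [FiniteDimensional k W] (N : Module.End k W) (S : Finset ℕ)
    (hS : ∀ a ∈ S, Module.finrank k
      (LinearMap.ker (aeval N (X - C ((a : k) * (a + 1))))) ≤ 1) :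
    Module.finrank k (LinearMap.ker (aeval N (casimirPoly k S))) ≤ S.card := by
  classical
  induction S using Finset.induction_on with
  | empty =>
    have h : LinearMap.ker (1 : Module.End k W) = ⊥ := by
      ext x; simp
    rw [casimirPoly, Finset.prod_empty, map_one, h, finrank_bot]
    exact Nat.zero_le _
  | insert a S ha ih =>
    rw [casimirPoly, Finset.prod_insert ha, map_mul, Finset.card_insert_of_notMem ha]
    have h1 := finrank_ker_mul_le (aeval N (X - C ((a : k) * (a + 1)))) (aeval N (casimirPoly k S))
    have h2 := hS a (Finset.mem_insert_self _ _)
    have h3 := ih fun b hb => hS b (Finset.mem_insert_of_mem hb)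
    rw [casimirPoly] at h1 h3
    omega

theorem isCoprime_casimirPoly {S T : Finset ℕ}
    (h : ∀ a ∈ S, ∀ b ∈ T, (a : k) * (a + 1) ≠ b * (b + 1)) :
    IsCoprime (casimirPoly k S) (casimirPoly k T) := by
  refine IsCoprime.prod_left fun a ha => IsCoprime.prod_right fun b hb => ?_
  exact isCoprime_X_sub_C_of_isUnit_sub (sub_ne_zero.mpr (h a ha b hb)).isUnit

/-- The factors with `a ∉ E` are coprime to the factors of exponents `≥ i`. The latter annihilate
the image of the product over exponents `< i`, so the former act injectively on that image and can
be dropped from the kernel. -/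
theorem ker_aeval_range_le {N : Module.End k W} {E : Finset ℕ}
    (hN : aeval N (casimirPoly k E) = 0)
    (hE : ∀ m ∈ E, ∀ a < m, a ∉ E → (a : k) * (a + 1) ≠ m * (m + 1)) (i : ℕ) :
    LinearMap.ker (aeval N (casimirPoly k (Finset.range i))) ≤
      LinearMap.ker (aeval N (casimirPoly k (E.filter (· < i)))) := by
  classical
  have h1 : casimirPoly k (Finset.range i) =
      casimirPoly k ((Finset.range i).filter (· ∉ E)) * casimirPoly k (E.filter (· < i)) := by
    rw [casimirPoly, ← Finset.prod_filter_mul_prod_filter_not (Finset.range i) (· ∉ E)]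
    congr 1
    refine Finset.prod_congr ?_ fun _ _ => rfl
    ext a; simp [and_comm]
  have h2 : casimirPoly k E =
      casimirPoly k (E.filter (¬ · < i)) * casimirPoly k (E.filter (· < i)) := by
    rw [casimirPoly, ← Finset.prod_filter_not_mul_prod_filter E (· < i)]
    rfl
  have h3 : IsCoprime (casimirPoly k ((Finset.range i).filter (· ∉ E)))
      (casimirPoly k (E.filter (¬ · < i))) := by
    refine isCoprime_casimirPoly fun a ha b hb => ?_
    simp only [Finset.mem_filter, Finset.mem_range, not_lt] at ha hb
    exact hE b hb.1 a (by omega) ha.2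
  obtain ⟨p, q, hpq⟩ := h3
  intro x hx
  rw [LinearMap.mem_ker] at hx ⊢
  rw [h1, map_mul] at hx
  rw [h2, map_mul] at hN
  have h4 : aeval N (casimirPoly k (E.filter (¬ · < i)))
      (aeval N (casimirPoly k (E.filter (· < i))) x) = 0 := by
    rw [← Module.End.mul_apply, hN]; rfl
  have h5 := congrArg (fun r => aeval N r (aeval N (casimirPoly k (E.filter (· < i))) x)) hpq
  simp only [map_add, map_mul, LinearMap.add_apply, Module.End.mul_apply, map_one,
    Module.End.one_apply, h4, map_zero, add_zero] at h5
  rw [← h5]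
  have h6 : (aeval N (casimirPoly k ((Finset.range i).filter (· ∉ E))))
      (aeval N (casimirPoly k (E.filter (· < i))) x) = 0 := hx
  rw [h6, map_zero]

theorem aeval_apply_of_intertwine {V : Type*} [AddCommGroup V] [Module k V] {c : Module.End k V}
    {N : Module.End k W} {T : W →ₗ[k] V} (h : ∀ u, c (T u) = T (N u)) (p : k[X]) (u : W) :
    aeval c p (T u) = T (aeval N p u) := by
  induction p using Polynomial.induction_on' with
  | add p q hp hq => simp [hp, hq]
  | monomial n a =>
    have : ∀ n u, (c ^ n) (T u) = T ((N ^ n) u) := by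
      intro n
      induction n with
      | zero => simp
      | succ n ih => intro u; rw [pow_succ, pow_succ, Module.End.mul_apply, h, ih]; rfl
    simp [aeval_monomial, this]

end LinearAlgebra

/-! ### Raising and lowering operators on a graded space -/

namespace IsGradedPair

variable {k V : Type*} [Field k] [AddCommGroup V] [Module k V] {G : ℤ → Submodule k V}
  {e f : Module.End k V}

/-- Transfers results on `e` in nonnegative degrees to `f` in nonpositive degrees. -/
theorem symm (h : IsGradedPair G e f) : IsGradedPair (fun j => G (-j)) f e where
  e_mem {j v} hv := by
    have := h.f_mem hv
    rwa [show -j - 1 = -(j + 1) by ring] at this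
  f_mem {j v} hv := by
    have := h.e_mem hv
    rwa [show -j + 1 = -(j - 1) by ring] at this
  comm {j v} hv := by
    rw [h.comm hv, add_assoc, ← add_smul]
    push_cast
    rw [show (2 * -(j : k) + 2 * j) = 0 by ring, zero_smul, add_zero]

theorem e_pow_mem (h : IsGradedPair G e f) {j : ℤ} {v : V} (hv : v ∈ G j) (i : ℕ) :
    (e ^ i) v ∈ G (j + i) := by
  induction i with
  | zero => simpa using hv
  | succ i ih =>
    rw [pow_succ', Module.End.mul_apply]
    have := h.e_mem ih
    rwa [show j + (i : ℤ) + 1 = j + ((i + 1 : ℕ) : ℤ) by push_cast; ring] at this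

theorem f_pow_mem (h : IsGradedPair G e f) {j : ℤ} {v : V} (hv : v ∈ G j) (i : ℕ) :
    (f ^ i) v ∈ G (j - i) := by
  have := h.symm.e_pow_mem (j := -j) (v := v) (by simpa using hv) i
  simpa [sub_eq_add_neg, add_comm] using this

/-- Moving `f` past `e` costs `2j` in degree `j`, and `2 (1 + ⋯ + i) = i (i + 1)`. -/
theorem f_e_pow (h : IsGradedPair G e f) {v : V} (hv : v ∈ G 0) (i : ℕ) :
    f ((e ^ (i + 1)) v) = (e ^ i) (f (e v)) - ((i : k) * (i + 1)) • (e ^ i) v := by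
  induction i with
  | zero => simp
  | succ i ih =>
    have h1 := h.comm (h.e_pow_mem hv (i + 1))
    rw [ih, map_sub, map_smul, ← Module.End.mul_apply, ← pow_succ', ← Module.End.mul_apply e,
      ← pow_succ'] at h1
    rw [pow_succ' e (i + 1), Module.End.mul_apply, eq_sub_iff_add_eq.mpr h1.symm, sub_sub,
      ← add_smul]
    congr 2
    push_cast
    ring

/-- The vectors `f ^ i v` for a highest weight vector `v`. -/
theorem e_f_pow (h : IsGradedPair G e f) {v : V} {j : ℤ} (hv : v ∈ G j) (hev : e v = 0) (i : ℕ) :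
    e ((f ^ (i + 1)) v) = (((i : k) + 1) * (2 * j - i)) • (f ^ i) v := by
  induction i with
  | zero => simp [h.comm hv, hev]
  | succ i ih =>
    have h1 := h.comm (h.f_pow_mem hv (i + 1))
    rw [ih, map_smul, ← Module.End.mul_apply f, ← pow_succ', ← Module.End.mul_apply f,
      ← pow_succ', ← add_smul] at h1
    rw [h1]
    congr 1
    push_cast
    ring

variable {W : Type*} [AddCommGroup W] [Module k W] {ι : W →ₗ[k] V} {N : Module.End k W}

theorem f_pow_e_pow (h : IsGradedPair G e f) (hι : ∀ u, ι u ∈ G 0)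
    (hN : ∀ u, f (e (ι u)) = ι (N u)) (i : ℕ) (u : W) :
    (f ^ i) ((e ^ i) (ι u)) = ι (aeval N (casimirPoly k (Finset.range i)) u) := by
  induction i generalizing u with
  | zero => simp [casimirPoly]
  | succ i ih =>
    rw [pow_succ f, Module.End.mul_apply, h.f_e_pow (hι u), map_sub, map_smul, hN, ih, ih,
      ← map_smul, ← map_sub, casimirPoly, casimirPoly, Finset.prod_range_succ, map_mul, Module.End.mul_apply]
    rw [aeval_X_sub_C_apply]
    simp only [map_sub, map_smul]

variable [FiniteDimensional k W] [FiniteDimensional k V]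

/-- If the parts of degree `i` are not larger than what the eigenvalues of `f e` on the part of
degree `0` predict, then `e ^ i` is onto and `f ^ i` is injective. -/
theorem surjective_and_injective (h : IsGradedPair G e f) (hι : ∀ u, ι u ∈ G 0)
    (hinj : Function.Injective ι) (hN : ∀ u, f (e (ι u)) = ι (N u)) {E : Finset ℕ}
    (hW : Module.finrank k W = E.card) (hχ : aeval N (casimirPoly k E) = 0)
    (hE : ∀ m ∈ E, ∀ a < m, a ∉ E → (a : k) * (a + 1) ≠ m * (m + 1))
    (heig : ∀ m ∈ E, Module.finrank k
      (LinearMap.ker (aeval N (X - C ((m : k) * (m + 1))))) ≤ 1) (i : ℕ)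
    (hG : Module.finrank k (G i) ≤ (E.filter (i ≤ ·)).card) :
    (∀ v ∈ G i, ∃ u, v = (e ^ i) (ι u)) ∧ (∀ v ∈ G i, (f ^ i) v = 0 → v = 0) ∧
      Module.finrank k (G i) = (E.filter (i ≤ ·)).card := by
  set q := aeval N (casimirPoly k (Finset.range i)) with hq
  have h1 : Module.finrank k (LinearMap.ker q) ≤ (E.filter (· < i)).card :=
    (Submodule.finrank_mono (ker_aeval_range_le hχ hE i)).trans
      (finrank_ker_aeval_casimirPoly_le N _ fun a ha => heig a (Finset.mem_filter.mp ha).1)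
  have h2 := LinearMap.finrank_range_add_finrank_ker q
  have h3 : (E.filter (· < i)).card + (E.filter (i ≤ ·)).card = E.card := by
    have := Finset.card_filter_add_card_filter_not (s := E) (· < i)
    simpa only [not_lt] using this
  have h4 : LinearMap.range ((e ^ i).comp ι) ≤ G i := by
    rintro _ ⟨u, rfl⟩
    simpa using h.e_pow_mem (hι u) i
  have h5 : (LinearMap.range ((e ^ i).comp ι)).map (f ^ i) = (LinearMap.range q).map ι := by
    ext v
    simp only [Submodule.mem_map, LinearMap.mem_range, LinearMap.comp_apply]
    constructor
    · rintro ⟨_, ⟨u, rfl⟩, rfl⟩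
      exact ⟨_, ⟨u, rfl⟩, (h.f_pow_e_pow hι hN i u).symm⟩
    · rintro ⟨_, ⟨u, rfl⟩, rfl⟩
      exact ⟨_, ⟨u, rfl⟩, h.f_pow_e_pow hι hN i u⟩
  have h6 : Module.finrank k ((LinearMap.range q).map ι) = Module.finrank k (LinearMap.range q) :=
    (Submodule.equivMapOfInjective ι hinj _).finrank_eq.symm
  have h7 := Submodule.finrank_map_le (f ^ i) (LinearMap.range ((e ^ i).comp ι))
  have h8 := Submodule.finrank_mono h4
  rw [h5, h6] at h7
  -- With `q = f^i e^i` on degree 0: `rank q ≥ #{m ∈ E, m ≥ i} ≥ dim G i ≥ rank e^i ≥ rank q`, so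
  -- all are equalities. The first gap closed gives surjectivity of `e^i`, the last one injectivity
  -- of `f^i`.
  have h9 : LinearMap.range ((e ^ i).comp ι) = G i :=
    Submodule.eq_of_le_of_finrank_le h4 (by omega)
  refine ⟨fun v hv => ?_, fun v hv hfv => ?_, by omega⟩
  · rw [← h9] at hv
    obtain ⟨u, rfl⟩ := hv
    exact ⟨u, rfl⟩
  · have h10 := LinearMap.finrank_range_add_finrank_ker ((f ^ i).domRestrict (G i))
    have h11 : LinearMap.range ((f ^ i).domRestrict (G i)) = (LinearMap.range q).map ι := by
      rw [← h5, h9, LinearMap.range_domRestrict]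
    rw [h11, h6] at h10
    have h12 : Module.finrank k (LinearMap.ker ((f ^ i).domRestrict (G i))) = 0 := by omega
    have h13 := Submodule.finrank_eq_zero.mp h12
    have h14 : (⟨v, hv⟩ : G i) ∈ LinearMap.ker ((f ^ i).domRestrict (G i)) := by simpa using hfv
    rw [h13, Submodule.mem_bot] at h14
    exact congrArg Subtype.val h14

end IsGradedPair

end

/-! ### Decimal codes of the positive roots -/

/-- The digit of `c` at position `j` in base `10`. -/
def decimalDigit (c j : ℕ) : ℤ := Int.ofNat (Nat.mod (Nat.div c (Nat.pow 10 j)) 10)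

/-- The vector whose coordinates are the digits of `c` at the positions from `o` on. -/
def digitVector (n o c : ℕ) : Fin n → ℤ := fun j => decimalDigit c (o + j)

/-- The code of the pair obtained by the `i`-th simple reflection from the pair with code `c`. -/
def codeReflect {n : ℕ} (A : Matrix (Fin n) (Fin n) ℤ) (o c : ℕ) (i : Fin n) : ℕ :=
  ((c : ℤ) - pairSimpleCoroot A (digitVector n 0 c) i * Int.ofNat (Nat.pow 10 i) -
    if o = 0 then 0 else
      pairSimpleRoot A i (digitVector n o c) * Int.ofNat (Nat.pow 10 (o + i))).toNat

/-- The code of the `i`-th simple root and coroot. -/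
def codeSimple {n : ℕ} (o : ℕ) (i : Fin n) : ℕ :=
  if o = 0 then 10 ^ (i : ℕ) else 10 ^ (i : ℕ) + 10 ^ (o + (i : ℕ))

/-- A list of codes `c`, of the pairs `(digitVector n 0 c, digitVector n o c)`, that is closed under
simple reflections up to the sign of simple roots. -/
structure IsPositiveRootCodes {n : ℕ} (A : Matrix (Fin n) (Fin n) ℤ) (o : ℕ) (L : List ℕ) :
    Prop where
  simple_mem : ∀ i : Fin n, codeSimple o i ∈ L
  simple_root : ∀ i j : Fin n, digitVector n 0 (codeSimple o i) j = (Pi.single i 1 : Fin n → ℤ) j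
  simple_coroot : ∀ i j : Fin n, digitVector n o (codeSimple o i) j = (Pi.single i 1 : Fin n → ℤ) j
  reflect : ∀ c ∈ L, ∀ i : Fin n, c = codeSimple o i ∨
    pairSimpleCoroot A (digitVector n 0 c) i = 0 ∧ pairSimpleRoot A i (digitVector n o c) = 0 ∨
    ∃ c' ∈ L, c' = codeReflect A o c i ∧
    (∀ j, digitVector n 0 c' j = digitVector n 0 c j -
      if j = i then pairSimpleCoroot A (digitVector n 0 c) i else 0) ∧
    ∀ j, digitVector n o c' j = digitVector n o c j -
      if j = i then pairSimpleRoot A i (digitVector n o c) else 0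
  diag : ∀ i, A i i = 2

/-- The positive roots of type `E_n`, for `n ≤ 8`, coded by their decimal digits. -/
def rootCodesE (n : ℕ) : List ℕ := (
  [10000000, 1000000, 100000, 10000, 1000, 100, 10, 1, 11000000, 1100000,
   110000, 11000, 1100, 1010, 101, 11100000, 1110000, 111000, 11100, 11010,
   1110, 1101, 11110000, 1111000, 111100, 111010, 11110, 11101, 1111,
   11111000, 1111100, 1111010, 111110, 12110, 111101, 11111, 11111100, 11111010,
   1111110, 112110, 1111101, 111111, 12111, 11111110, 1112110, 122110, 11111101,
   1111111, 112111, 12211, 11112110, 1122110, 11111111, 1112111, 122111, 112211,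
   11122110, 1222110, 11112111, 1122111, 1112211, 122211, 11222110, 11122111,
   1222111, 11112211, 1122211, 123211, 12222110, 11222111, 11122211, 1222211,
   1123211, 123221, 12222111, 11222211, 11123211, 1223211, 1123221, 12222211,
   11223211, 1233211, 11123221, 1223221, 12223211, 11233211, 11223221, 1233221,
   12233211, 12223221, 11233221, 1234221, 12333211, 12233221, 11234221, 1234321,
   12333221, 12234221, 11234321, 1234322, 12334221, 12234321, 11234322, 12344221,
   12334321, 12234322, 12344321, 12334322, 12345321, 12344322, 12345331, 12345322,
   12345422, 12345332, 12345432, 12346432, 12356432, 12456432, 13456432, 23456432]).filter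
    (· < 10 ^ n)

/-- The positive roots and coroots of type `F₄`. -/
def rootCodesF₄ : List ℕ :=
  [10001000, 1000100, 100010, 10001, 11001100, 1200110, 110011, 11201110,
   1100210, 1220111, 12201210, 11221111, 1110211, 11102210, 12221211, 1210221,
   11112211, 12421221, 11212221, 13421321, 23422321, 12212421, 12312431, 12322432]

/-- The positive roots and coroots of type `G₂`. -/
def rootCodesG₂ : List ℕ :=
  [1010, 101, 1311, 2321, 1131, 1232]

/-- The sum of the coordinates of `digitVector n 0 c`. -/
def codeHeight (n c : ℕ) : ℤ := ∑ j, digitVector n 0 c j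

/-- There are at most as many roots of height `i` as elements of `E` that are at least `i`, and the
heights are positive and less than `h`. -/
structure HeightBound (n h : ℕ) (E : Finset ℕ) (L : List ℕ) : Prop where
  pos_lt : ∀ c ∈ L, 0 < codeHeight n c ∧ codeHeight n c < h
  count : ∀ i < h, (L.map (codeHeight n)).count (i : ℤ) ≤ (E.filter (i ≤ ·)).card

instance (n h : ℕ) (E : Finset ℕ) (L : List ℕ) : Decidable (HeightBound n h E L) :=
  decidable_of_iff (_ ∧ _) ⟨fun ⟨a, b⟩ => ⟨a, b⟩, fun ⟨a, b⟩ => ⟨a, b⟩⟩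

instance {n : ℕ} (A : Matrix (Fin n) (Fin n) ℤ) (o : ℕ) (L : List ℕ) : Decidable
    (IsPositiveRootCodes A o L) :=
  decidable_of_iff (_ ∧ _ ∧ _ ∧ _ ∧ _) ⟨fun ⟨a, b, c, d, e⟩ => ⟨a, b, c, d, e⟩,
    fun ⟨a, b, c, d, e⟩ => ⟨a, b, c, d, e⟩⟩

/-- A finite closure check. For `G₂` and `F₄` the offset is the rank, which puts the coroot digits
after the root digits. In the simply laced types roots and coroots have the same coordinates, so
offset 0 lets one block of digits serve for both; `E₆` and `E₇` are the roots of `E₈` supported on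
the first nodes. -/
theorem isPositiveRootCodes_G₂ : IsPositiveRootCodes CartanMatrix.G₂ 2 rootCodesG₂ := by
  decide +kernel
theorem isPositiveRootCodes_F₄ : IsPositiveRootCodes CartanMatrix.F₄ 4 rootCodesF₄ := by
  decide +kernel
theorem isPositiveRootCodes_E₆ : IsPositiveRootCodes CartanMatrix.E₆ 0 (rootCodesE 6) := by
  decide +kernel
theorem isPositiveRootCodes_E₇ : IsPositiveRootCodes CartanMatrix.E₇ 0 (rootCodesE 7) := by
  decide +kernel
theorem isPositiveRootCodes_E₈ : IsPositiveRootCodes CartanMatrix.E₈ 0 (rootCodesE 8) := by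
  decide +kernel

/-- This is one half of the duality between exponents and heights. Only the upper bound is needed;
equality comes out of the rank count for `f^i e^i`. -/
theorem heightBound_G₂ : HeightBound 2 6 (ExceptionalType.exponents .G₂) rootCodesG₂ := by
  decide +kernel

theorem heightBound_F₄ : HeightBound 4 12 (ExceptionalType.exponents .F₄) rootCodesF₄ := by
  decide +kernel

theorem heightBound_E₆ : HeightBound 6 12 (ExceptionalType.exponents .E₆) (rootCodesE 6) := by
  decide +kernel

theorem heightBound_E₇ : HeightBound 7 18 (ExceptionalType.exponents .E₇) (rootCodesE 7) := by
  decide +kernel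

theorem heightBound_E₈ : HeightBound 8 30 (ExceptionalType.exponents .E₈) (rootCodesE 8) := by
  decide +kernel

theorem pairSimpleCoroot_neg {n : ℕ} (A : Matrix (Fin n) (Fin n) ℤ) (v : Fin n → ℤ) (i : Fin n) :
    pairSimpleCoroot A (-v) i = -pairSimpleCoroot A v i := by
  simp [pairSimpleCoroot]

theorem pairSimpleRoot_neg {n : ℕ} (A : Matrix (Fin n) (Fin n) ℤ) (w : Fin n → ℤ) (i : Fin n) :
    pairSimpleRoot A i (-w) = -pairSimpleRoot A i w := by
  simp [pairSimpleRoot]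

theorem pairSimpleCoroot_single {n : ℕ} (A : Matrix (Fin n) (Fin n) ℤ) (i j : Fin n) :
    pairSimpleCoroot A (Pi.single i 1) j = A i j := by
  simp [pairSimpleCoroot, Pi.single_apply]

theorem pairSimpleRoot_single {n : ℕ} (A : Matrix (Fin n) (Fin n) ℤ) (i j : Fin n) :
    pairSimpleRoot A i (Pi.single j 1) = A i j := by
  simp [pairSimpleRoot, Pi.single_apply]

/-- The height of a root. -/
def Root.height {n : ℕ} {A : Matrix (Fin n) (Fin n) ℤ} (α : Root A) : ℤ := ∑ j, α.root j

@[simp]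
theorem height_simpleRoot {n : ℕ} (A : Matrix (Fin n) (Fin n) ℤ) (i : Fin n) :
    (simpleRoot A i).height = 1 := by
  simp [Root.height, simpleRoot]

@[simp]
theorem height_negSimpleRoot {n : ℕ} (A : Matrix (Fin n) (Fin n) ℤ) (i : Fin n) :
    (negSimpleRoot A i).height = -1 := by
  simp [Root.height, negSimpleRoot]

theorem simpleRoot_injective {n : ℕ} (A : Matrix (Fin n) (Fin n) ℤ) :
    Function.Injective (simpleRoot A) := by
  intro i j h
  have := congrFun (congrArg Root.root h) j
  by_contra hij
  simp [simpleRoot, Ne.symm hij] at this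

theorem negSimpleRoot_injective {n : ℕ} (A : Matrix (Fin n) (Fin n) ℤ) :
    Function.Injective (negSimpleRoot A) := by
  intro i j h
  have := congrFun (congrArg Root.root h) j
  by_contra hij
  simp [negSimpleRoot, Ne.symm hij] at this

theorem digitVector_nonneg (n o c : ℕ) : 0 ≤ digitVector n o c := fun _ => Int.natCast_nonneg _

/-! ### Finiteness and heights of the roots -/

namespace IsPositiveRootCodes

variable {n o : ℕ} {A : Matrix (Fin n) (Fin n) ℤ} {L : List ℕ}

/-- The list together with its negatives is closed under the three rules that generate root pairs.
Nothing requires every code to be a root: only upper bounds are drawn from the list. -/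
theorem exists_code_aux (hL : IsPositiveRootCodes A o L) {v w : Fin n → ℤ}
    (h : IsRootPair A v w) : ∃ c ∈ L, (v = digitVector n 0 c ∧ w = digitVector n o c) ∨
      (v = -digitVector n 0 c ∧ w = -digitVector n o c) := by
  induction h with
  | simple i =>
    exact ⟨_, hL.simple_mem i, .inl ⟨funext fun j => (hL.simple_root i j).symm,
      funext fun j => (hL.simple_coroot i j).symm⟩⟩
  | neg _ ih =>
    obtain ⟨c, hc, ⟨rfl, rfl⟩ | ⟨rfl, rfl⟩⟩ := ih
    · exact ⟨c, hc, .inr ⟨rfl, rfl⟩⟩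
    · exact ⟨c, hc, .inl ⟨neg_neg _, neg_neg _⟩⟩
  | @reflect i v w _ ih =>
    have key : ∀ c ∈ L, ∃ c' ∈ L,
        (digitVector n 0 c - pairSimpleCoroot A (digitVector n 0 c) i • Pi.single i 1 =
          digitVector n 0 c' ∧
          digitVector n o c - pairSimpleRoot A i (digitVector n o c) • Pi.single i 1 =
          digitVector n o c') ∨
        (digitVector n 0 c - pairSimpleCoroot A (digitVector n 0 c) i • Pi.single i 1 =
          -digitVector n 0 c' ∧
          digitVector n o c - pairSimpleRoot A i (digitVector n o c) • Pi.single i 1 =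
          -digitVector n o c') := by
      intro c hc
      obtain rfl | ⟨h1, h2⟩ | ⟨c', hc', -, h1, h2⟩ := hL.reflect c hc i
      · have h3 : digitVector n 0 (codeSimple o i) = Pi.single i 1 := funext (hL.simple_root i)
        have h4 : digitVector n o (codeSimple o i) = Pi.single i 1 := funext (hL.simple_coroot i)
        refine ⟨_, hc, .inr ?_⟩
        -- The one case in which positivity is lost: `s_i` sends `α_i` to `-α_i`, since `A i i = 2`.
        rw [h3, h4, pairSimpleCoroot_single, pairSimpleRoot_single, hL.diag]
        constructor <;> module
      · exact ⟨c, hc, .inl (by simp [h1, h2])⟩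
      · refine ⟨c', hc', .inl ⟨funext fun j => ?_, funext fun j => ?_⟩⟩
        · rw [h1 j]; by_cases hj : j = i <;> simp [hj]
        · rw [h2 j]; by_cases hj : j = i <;> simp [hj]
    obtain ⟨c, hc, ⟨rfl, rfl⟩ | ⟨rfl, rfl⟩⟩ := ih
    · exact key c hc
    · obtain ⟨c', hc', h⟩ := key c hc
      refine ⟨c', hc', ?_⟩
      rw [pairSimpleCoroot_neg, pairSimpleRoot_neg]
      rcases h with ⟨h1, h2⟩ | ⟨h1, h2⟩
      · refine .inr ⟨?_, ?_⟩
        · rw [← h1]; module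
        · rw [← h2]; module
      · refine .inl ⟨?_, ?_⟩
        · rw [← neg_eq_iff_eq_neg.mpr h1]; module
        · rw [← neg_eq_iff_eq_neg.mpr h2]; module

theorem exists_code (hL : IsPositiveRootCodes A o L) (α : Root A) :
    ∃ c ∈ L, (α.root = digitVector n 0 c ∧ α.coroot = digitVector n o c ∧
      α.height = codeHeight n c) ∨
      (α.root = -digitVector n 0 c ∧ α.coroot = -digitVector n o c ∧
        α.height = -codeHeight n c) := by
  obtain ⟨c, hc, h⟩ := hL.exists_code_aux α.isRootPair
  refine ⟨c, hc, h.imp (fun h => ⟨h.1, h.2, ?_⟩) fun h => ⟨h.1, h.2, ?_⟩⟩ <;>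
    simp [Root.height, codeHeight, h.1]

variable {h : ℕ} {E : Finset ℕ}

/-- The code of the positive root among `α` and `-α`. -/
noncomputable def code (hL : IsPositiveRootCodes A o L) (α : Root A) : ℕ :=
  (hL.exists_code α).choose

theorem code_mem (hL : IsPositiveRootCodes A o L) (α : Root A) : hL.code α ∈ L :=
  (hL.exists_code α).choose_spec.1

theorem code_spec (hL : IsPositiveRootCodes A o L) (α : Root A) :
    (α.root = digitVector n 0 (hL.code α) ∧ α.coroot = digitVector n o (hL.code α) ∧
      α.height = codeHeight n (hL.code α)) ∨
    (α.root = -digitVector n 0 (hL.code α) ∧ α.coroot = -digitVector n o (hL.code α) ∧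
      α.height = -codeHeight n (hL.code α)) :=
  (hL.exists_code α).choose_spec.2

theorem root_ext {α β : Root A} (h1 : α.root = β.root) (h2 : α.coroot = β.coroot) : α = β := by
  cases α; cases β; simp_all

theorem nonneg_or_nonpos (hL : IsPositiveRootCodes A o L) (α : Root A) :
    0 ≤ α.root ∨ α.root ≤ 0 := by
  obtain ⟨c, -, ⟨h1, -⟩ | ⟨h1, -⟩⟩ := hL.exists_code α
  · exact .inl (h1 ▸ digitVector_nonneg n 0 c)
  · exact .inr (h1 ▸ neg_nonpos.mpr (digitVector_nonneg n 0 c))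

theorem height_ne_zero (hL : IsPositiveRootCodes A o L) (hb : HeightBound n h E L) (α : Root A) :
    α.height ≠ 0 := by
  have h2 := hb.pos_lt _ (hL.code_mem α)
  obtain ⟨-, -, h1⟩ | ⟨-, -, h1⟩ := hL.code_spec α <;> omega

theorem abs_height_lt (hL : IsPositiveRootCodes A o L) (hb : HeightBound n h E L) (α : Root A) :
    |α.height| < h := by
  have h2 := hb.pos_lt _ (hL.code_mem α)
  obtain ⟨-, -, h1⟩ | ⟨-, -, h1⟩ := hL.code_spec α <;> rw [abs_lt] <;> omega

theorem eq_of_code_eq (hL : IsPositiveRootCodes A o L) (hb : HeightBound n h E L) {α β : Root A}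
    (hc : hL.code α = hL.code β) (hs : 0 < α.height ↔ 0 < β.height) : α = β := by
  have h1 := hb.pos_lt _ (hL.code_mem β)
  obtain ⟨a1, a2, a3⟩ | ⟨a1, a2, a3⟩ := hL.code_spec α <;>
  obtain ⟨b1, b2, b3⟩ | ⟨b1, b2, b3⟩ := hL.code_spec β <;>
  rw [hc] at a1 a2 a3
  · exact root_ext (a1.trans b1.symm) (a2.trans b2.symm)
  · omega
  · omega
  · exact root_ext (a1.trans b1.symm) (a2.trans b2.symm)

theorem finite_root (hL : IsPositiveRootCodes A o L) (hb : HeightBound n h E L) :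
    Finite (Root A) := by
  have : Function.Injective fun α : Root A =>
      ((⟨hL.code α, List.mem_toFinset.mpr (hL.code_mem α)⟩ : L.toFinset),
        decide (0 < α.height)) := by
    intro α β hαβ
    simp only [Prod.mk.injEq, Subtype.mk.injEq, decide_eq_decide] at hαβ
    exact hL.eq_of_code_eq hb hαβ.1 hαβ.2
  exact Finite.of_injective _ this

theorem card_height_eq_le (hL : IsPositiveRootCodes A o L) (hb : HeightBound n h E L)
    [Fintype (Root A)] {i : ℕ} (hi : 0 < i) (s : ℤ) (hs : s = i ∨ s = -i) :
    (Finset.univ.filter fun α : Root A => α.height = s).card ≤ (E.filter (i ≤ ·)).card := by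
  have h0 : ∀ α : Root A, α.height = s → codeHeight n (hL.code α) = i := by
    intro α hα
    have h1 := hb.pos_lt _ (hL.code_mem α)
    obtain ⟨-, -, h2⟩ | ⟨-, -, h2⟩ := hL.code_spec α <;> omega
  by_cases hih : i < h
  · refine le_trans ?_ (hb.count i hih)
    rw [List.count_eq_countP, List.countP_map, List.countP_eq_length_filter]
    refine le_trans ?_ (List.toFinset_card_le _)
    refine Finset.card_le_card_of_injOn hL.code (fun α hα => ?_) fun α hα β hβ hc => ?_
    · have := h0 α (by simpa using hα)
      simpa [hL.code_mem] using this
    · have hα' : α.height = s := by simpa using hα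
      have hβ' : β.height = s := by simpa using hβ
      exact hL.eq_of_code_eq hb hc (by rw [hα', hβ'])
  · rw [Finset.card_eq_zero.mpr]
    · exact Nat.zero_le _
    · refine Finset.filter_eq_empty_iff.mpr fun α _ hα => ?_
      have h1 := hb.pos_lt _ (hL.code_mem α)
      have h2 := h0 α hα
      omega

end IsPositiveRootCodes

/-! ### Integral data and their reduction to `k` -/

/-- Integral data for a Cartan matrix `A`: the positive roots, the exponents `E`, the Coxeter number
`h`, the coefficients `c` of `2ρ^∨`, and the eigenvectors `U m` of the matrix `(c_i A_ij)`. -/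
structure PrincipalDatum {n : ℕ} (A : Matrix (Fin n) (Fin n) ℤ) (E : Finset ℕ) (h : ℕ)
    (c : Fin n → ℤ) (U : ℕ → Fin n → ℤ) (l : Fin n) : Prop where
  exists_codes : ∃ o L, IsPositiveRootCodes A o L ∧ HeightBound n h E L
  sum_mul_c : ∀ i, ∑ j, A i j * c j = 2
  eigen : ∀ m ∈ E, ∀ i, c i * ∑ j, A i j * U m j = m * (m + 1) * U m i
  card : E.card = n
  two_lt : 2 < h
  pos_lt : ∀ m ∈ E, 0 < m ∧ m < h
  -- Dividing a power of `(h - 1)!` means being nonzero with all prime factors below `h`, hence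
  -- being nonzero in `k` when `ℓ = 0` or `ℓ ≥ h`. The power 20 is only a sufficiently large
  -- multiplicity.
  det_dvd : A.det ∣ (((h - 1).factorial : ℕ) : ℤ) ^ 20
  last_dvd : ∀ m ∈ E, U m l ∣ (((h - 1).factorial : ℕ) : ℤ) ^ 20
  casimir_dvd : ∀ m ∈ E, ∀ a < m, a ∉ E →
    ((m : ℤ) * (m + 1) - a * (a + 1)) ∣ (((h - 1).factorial : ℕ) : ℤ) ^ 20
  eigenvalue_dvd : ∀ m ∈ E, ((m : ℤ) * (m + 1)) ∣ (((h - 1).factorial : ℕ) : ℤ) ^ 20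
  diff_dvd : ∀ m ∈ E, ∀ a ∈ E, a < m →
    ((m : ℤ) * (m + 1) - a * (a + 1)) ∣ (((2 * h - 2).factorial : ℕ) : ℤ) ^ 20

section Cast

variable {k : Type*} [Field k]

theorem intCast_ne_zero_of_dvd {a b : ℤ} (h : a ∣ b) (hb : (b : k) ≠ 0) : (a : k) ≠ 0 := by
  rintro ha
  obtain ⟨c, rfl⟩ := h
  exact hb (by rw [Int.cast_mul, ha, zero_mul])

variable (ℓ : ℕ) [CharP k ℓ]

theorem natCast_factorial_ne_zero {N : ℕ} (h : ℓ = 0 ∨ N < ℓ) : ((N.factorial : ℕ) : k) ≠ 0 := by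
  rw [Ne, CharP.cast_eq_zero_iff k ℓ]
  rcases CharP.char_is_prime_or_zero k ℓ with hp | rfl
  · rw [hp.dvd_factorial]
    have := hp.pos
    omega
  · simpa using Nat.factorial_ne_zero N

theorem intCast_ne_zero_of_dvd_factorial {N : ℕ} (h : ℓ = 0 ∨ N < ℓ) {a : ℤ} {r : ℕ}
    (ha : a ∣ ((N.factorial : ℕ) : ℤ) ^ r) : (a : k) ≠ 0 := by
  refine intCast_ne_zero_of_dvd ha ?_
  push_cast
  exact pow_ne_zero _ (natCast_factorial_ne_zero ℓ h)

end Cast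

/-- The matrix `(c_i A_ij)` over `k`. -/
noncomputable def cartanEnd {n : ℕ} (A : Matrix (Fin n) (Fin n) ℤ) (c : Fin n → ℤ) (k : Type*)
    [Field k] :
    Module.End k (Fin n → k) :=
  Matrix.mulVecLin (Matrix.of fun i j => ((c i * A i j : ℤ) : k))

theorem cartanEnd_apply {n : ℕ} (A : Matrix (Fin n) (Fin n) ℤ) (c : Fin n → ℤ) {k : Type*} [Field k]
    (u : Fin n → k) (i : Fin n) :
    cartanEnd A c k u i = (c i : k) * ∑ j, (A i j : k) * u j := by
  simp [cartanEnd, Matrix.mulVec, dotProduct, Finset.mul_sum, mul_assoc]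

/-- The degree of a basis element: the height of a root, and `0` for the coroot vectors. -/
def basisDegree {n : ℕ} (A : Matrix (Fin n) (Fin n) ℤ) : Fin n ⊕ Root A → ℤ :=
  Sum.elim 0 Root.height

/-! ### The relations of the principal `sl₂` and the grading by height -/

namespace ChevalleyBasis

variable {n : ℕ} {A : Matrix (Fin n) (Fin n) ℤ} {k g : Type*} [Field k] [LieRing g]
  [LieAlgebra k g]

section Sl2

variable {B : ChevalleyBasis A k g} {φ : LieAlgebra.SpecialLinear.sl (Fin 2) k →ₗ⁅k⁆ g}

-- Since `φ` is a homomorphism, the relations among `X`, `H`, `Y` follow from those of `2 × 2`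
-- matrices, with no computation in the root system.
open LieAlgebra.SpecialLinear in
theorem lie_principal (hφ : B.IsPrincipal φ) (s t : sl (Fin 2) k) :
    ⁅s.1 0 1 • B.principalX + s.1 0 0 • B.principalH + s.1 1 0 • B.principalY,
      t.1 0 1 • B.principalX + t.1 0 0 • B.principalH + t.1 1 0 • B.principalY⁆ =
    ⁅s.1, t.1⁆ 0 1 • B.principalX + ⁅s.1, t.1⁆ 0 0 • B.principalH +
      ⁅s.1, t.1⁆ 1 0 • B.principalY := by
  rw [← hφ, ← hφ, ← LieHom.map_lie, hφ]
  rfl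

/-- The standard basis of `sl₂`. -/
def slMatrix (k : Type*) [Field k] (a b c : k) :
    LieAlgebra.SpecialLinear.sl (Fin 2) k :=
  ⟨!![b, a; c, -b], by
    change Matrix.trace (!![b, a; c, -b] : Matrix (Fin 2) (Fin 2) k) = 0
    simp [Matrix.trace_fin_two]⟩

theorem lie_X_Y (hφ : B.IsPrincipal φ) : ⁅B.principalX, B.principalY⁆ = B.principalH := by
  have := lie_principal hφ (slMatrix k 1 0 0) (slMatrix k 0 0 1)
  simpa [slMatrix, Ring.lie_def, Matrix.mul_apply, Fin.sum_univ_two] using this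

theorem lie_H_X (hφ : B.IsPrincipal φ) : ⁅B.principalH, B.principalX⁆ = (2 : k) • B.principalX := by
  have := lie_principal hφ (slMatrix k 0 1 0) (slMatrix k 1 0 0)
  simpa [slMatrix, Ring.lie_def, Matrix.mul_apply, Fin.sum_univ_two, one_add_one_eq_two] using this

theorem lie_H_Y (hφ : B.IsPrincipal φ) :
    ⁅B.principalH, B.principalY⁆ = (-2 : k) • B.principalY := by
  have := lie_principal hφ (slMatrix k 0 1 0) (slMatrix k 0 0 1)
  have h2 : (-1 - 1 : k) = -2 := by ring
  simpa [slMatrix, Ring.lie_def, Matrix.mul_apply, Fin.sum_univ_two, h2] using this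

end Sl2

variable (B : ChevalleyBasis A k g)

/-- The span of the basis elements of degree `j`. -/
def degreeSpace (j : ℤ) : Submodule k g :=
  Submodule.span k (B.basis '' {b | basisDegree A b = j})

/-- The projection to the part of degree `j`. -/
noncomputable def degreeProj (j : ℤ) : Module.End k g :=
  B.basis.constr k fun b => if basisDegree A b = j then B.basis b else 0

theorem basis_mem_degreeSpace (b : Fin n ⊕ Root A) :
    B.basis b ∈ B.degreeSpace (basisDegree A b) :=
  Submodule.subset_span ⟨b, rfl, rfl⟩

theorem degreeProj_basis (j : ℤ) (b : Fin n ⊕ Root A) :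
    B.degreeProj j (B.basis b) = if basisDegree A b = j then B.basis b else 0 := by
  rw [degreeProj, Module.Basis.constr_basis]

theorem degreeProj_of_mem {i j : ℤ} {v : g} (hv : v ∈ B.degreeSpace i) :
    B.degreeProj j v = if i = j then v else 0 := by
  refine Submodule.span_induction ?_ ?_ ?_ ?_ hv
  · rintro _ ⟨b, rfl, rfl⟩
    rw [degreeProj_basis]
  · simp
  · intro x y _ _ hx hy
    rw [map_add, hx, hy]
    split_ifs <;> simp
  · intro a x _ hx
    rw [map_smul, hx]
    split_ifs <;> simp

theorem degreeProj_mem (j : ℤ) (v : g) : B.degreeProj j v ∈ B.degreeSpace j := by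
  refine Submodule.span_induction (p := fun v _ => B.degreeProj j v ∈ B.degreeSpace j) ?_ ?_ ?_ ?_
    (B.basis.mem_span v)
  · rintro _ ⟨b, rfl⟩
    rw [degreeProj_basis]
    split_ifs with h
    · exact h ▸ B.basis_mem_degreeSpace b
    · exact zero_mem _
  · simp
  · intro x y _ _ hx hy
    rw [map_add]
    exact add_mem hx hy
  · intro a x _ hx
    rw [map_smul]
    exact Submodule.smul_mem _ _ hx

/-- An endomorphism of degree `d` commutes with the projections. -/
theorem degreeProj_comm {T : Module.End k g} {d : ℤ}
    (hT : ∀ j v, v ∈ B.degreeSpace j → T v ∈ B.degreeSpace (j + d)) (j : ℤ) (v : g) :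
    B.degreeProj (j + d) (T v) = T (B.degreeProj j v) := by
  have : (B.degreeProj (j + d)).comp T = T.comp (B.degreeProj j) := by
    refine B.basis.ext fun b => ?_
    rw [LinearMap.comp_apply, LinearMap.comp_apply, degreeProj_basis,
      B.degreeProj_of_mem (hT _ _ (B.basis_mem_degreeSpace b))]
    by_cases h : basisDegree A b = j <;> simp [h]
  exact LinearMap.congr_fun this v

section

variable {E : Finset ℕ} {h : ℕ} {c : Fin n → ℤ} {U : ℕ → Fin n → ℤ} {l : Fin n}

theorem _root_.PrincipalDatum.finite_root (D : PrincipalDatum A E h c U l) : Finite (Root A) := by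
  obtain ⟨o, L, hL, hb⟩ := D.exists_codes
  exact hL.finite_root hb

theorem _root_.PrincipalDatum.abs_basisDegree_lt (D : PrincipalDatum A E h c U l)
    (b : Fin n ⊕ Root A) : |basisDegree A b| < h := by
  obtain ⟨o, L, hL, hb⟩ := D.exists_codes
  rcases b with i | α
  · have := D.two_lt
    simp [basisDegree]
    omega
  · exact hL.abs_height_lt hb α

theorem _root_.PrincipalDatum.basisDegree_inr_ne_zero (D : PrincipalDatum A E h c U l)
    (α : Root A) :
    basisDegree A (.inr α) ≠ 0 := by
  obtain ⟨o, L, hL, hb⟩ := D.exists_codes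
  exact hL.height_ne_zero hb α

theorem finiteDimensional (B : ChevalleyBasis A k g) (D : PrincipalDatum A E h c U l) :
    FiniteDimensional k g := by
  have := D.finite_root
  exact Module.Finite.of_basis B.basis

theorem sum_degreeProj (D : PrincipalDatum A E h c U l) (v : g) :
    ∑ j ∈ Finset.Ioo (-(h : ℤ)) h, B.degreeProj j v = v := by
  have : ∑ j ∈ Finset.Ioo (-(h : ℤ)) h, B.degreeProj j = LinearMap.id := by
    refine B.basis.ext fun b => ?_
    rw [LinearMap.sum_apply, LinearMap.id_apply]
    simp only [degreeProj_basis]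
    rw [Finset.sum_ite_eq, if_pos]
    exact Finset.mem_Ioo.mpr (abs_lt.mp (D.abs_basisDegree_lt b))
  simpa using LinearMap.congr_fun this v

theorem degreeProj_eq_zero (D : PrincipalDatum A E h c U l) {j : ℤ} (hj : (h : ℤ) ≤ |j|) :
    B.degreeProj j = 0 := by
  refine B.basis.ext fun b => ?_
  rw [degreeProj_basis, if_neg, LinearMap.zero_apply]
  rintro rfl
  exact absurd (D.abs_basisDegree_lt b) (not_lt.mpr hj)

theorem finrank_degreeSpace_le (D : PrincipalDatum A E h c U l)
    {i : ℕ} (hi : 0 < i) (s : ℤ) (hs : s = i ∨ s = -i) :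
    Module.finrank k (B.degreeSpace s) ≤ (E.filter (i ≤ ·)).card := by
  classical
  obtain ⟨o, L, hL, hb⟩ := D.exists_codes
  have := hL.finite_root hb
  have := Fintype.ofFinite (Root A)
  refine le_trans ?_ (hL.card_height_eq_le hb hi s hs)
  have h1 : B.degreeSpace s = Submodule.span k
      (((Finset.univ.filter fun α : Root A => α.height = s).image
        fun α => B.basis (.inr α) : Finset g) : Set g) := by
    rw [degreeSpace]
    congr 1
    ext v
    simp only [Set.mem_image, Set.mem_ofPred_eq, Finset.coe_image, Finset.coe_filter,
      Finset.mem_univ, true_and]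
    constructor
    · rintro ⟨i | α, h1, rfl⟩
      · simp only [basisDegree, Sum.elim_inl, Pi.zero_apply] at h1
        omega
      · exact ⟨α, h1, rfl⟩
    · rintro ⟨α, h1, rfl⟩
      exact ⟨.inr α, h1, rfl⟩
  rw [h1]
  exact (finrank_span_finset_le_card _).trans Finset.card_image_le

end

end ChevalleyBasis

/-! ### The operators `ad X`, `ad H`, `ad Y` -/

namespace ChevalleyBasis

variable {n : ℕ} {A : Matrix (Fin n) (Fin n) ℤ} {k g : Type*} [Field k] [LieRing g]
  [LieAlgebra k g] (B : ChevalleyBasis A k g) {E : Finset ℕ} {h : ℕ} {c : Fin n → ℤ}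
  {U : ℕ → Fin n → ℤ} {l : Fin n}

theorem lie_root_basis_mem (D : PrincipalDatum A E h c U l) (α : Root A) (b : Fin n ⊕ Root A) :
    ⁅B.basis (.inr α), B.basis b⁆ ∈ B.degreeSpace (basisDegree A b + α.height) := by
  have hx : ∀ β : Root A, B.basis (.inr β) ∈ B.degreeSpace β.height :=
    fun β => B.basis_mem_degreeSpace (.inr β)
  rcases b with i | β
  · rw [← lie_skew, B.lie_h_x]
    refine neg_mem (zsmul_mem ?_ _)
    simpa [basisDegree] using hx α
  · have hadd : ∀ γ : Root A, γ.root = α.root + β.root → γ.height = β.height + α.height := by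
      intro γ hγ
      simp [Root.height, hγ, Finset.sum_add_distrib, add_comm]
    by_cases h0 : α.root + β.root = 0
    · have h1 : basisDegree A (.inr β) + α.height = 0 := by
        have : ∑ j, (α.root + β.root) j = 0 := by rw [h0]; simp
        simpa [basisDegree, Root.height, Finset.sum_add_distrib, add_comm] using this
      rw [B.lie_x_neg α β h0, h1]
      exact sum_mem fun i _ => zsmul_mem (B.basis_mem_degreeSpace (.inl i)) _
    by_cases hγ : ∃ γ : Root A, γ.root = α.root + β.root
    · obtain ⟨γ, hγ⟩ := hγ
      have h2 : basisDegree A (.inr β) + α.height = γ.height := by simp [basisDegree, hadd γ hγ]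
      -- The bracket relation is available only for an actual greatest `r`. It exists because
      -- heights of roots are bounded and `α` has nonzero height.
      have hbdd : BddAbove {q : ℕ | ∃ δ : Root A, δ.root = β.root - q • α.root} := by
        refine ⟨2 * h, ?_⟩
        rintro q ⟨δ, hδ⟩
        have h3 : δ.height = β.height - q * α.height := by
          simp [Root.height, hδ, Finset.sum_sub_distrib, Finset.mul_sum]
        have h4 := abs_lt.mp (D.abs_basisDegree_lt (.inr δ))
        have h5 := abs_lt.mp (D.abs_basisDegree_lt (.inr β))
        have h6 := D.basisDegree_inr_ne_zero α
        simp only [basisDegree, Sum.elim_inr] at h4 h5 h6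
        rcases lt_or_gt_of_ne h6 with h7 | h7
        · zify
          nlinarith
        · zify
          nlinarith
      have hr := Nat.sSup_mem (s := {q : ℕ | ∃ δ : Root A, δ.root = β.root - q • α.root})
        ⟨0, β, by simp⟩ hbdd
      rw [h2]
      rcases B.lie_x_x α β γ hγ.symm _ ⟨hr, fun q hq => le_csSup hbdd hq⟩ with h3 | h3 <;> rw [h3]
      · exact nsmul_mem (hx γ) _
      · exact neg_mem (nsmul_mem (hx γ) _)
    · rw [B.lie_x_x_zero α β h0 fun γ h => hγ ⟨γ, h⟩]
      exact zero_mem _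

/-- The operator `ad X`. -/
noncomputable def adX : Module.End k g := LieAlgebra.ad k g B.principalX

/-- The operator `ad H`. -/
noncomputable def adH : Module.End k g := LieAlgebra.ad k g B.principalH

/-- The operator `ad Y`. -/
noncomputable def adY : Module.End k g := LieAlgebra.ad k g B.principalY

theorem adX_apply (v : g) : B.adX v = ⁅B.principalX, v⁆ := rfl

theorem adH_apply (v : g) : B.adH v = ⁅B.principalH, v⁆ := rfl

theorem adY_apply (v : g) : B.adY v = ⁅B.principalY, v⁆ := rfl

theorem map_mem_degreeSpace {T : Module.End k g} {d : ℤ}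
    (hT : ∀ b, T (B.basis b) ∈ B.degreeSpace (basisDegree A b + d)) {j : ℤ} {v : g}
    (hv : v ∈ B.degreeSpace j) : T v ∈ B.degreeSpace (j + d) := by
  refine Submodule.span_induction (p := fun v _ => T v ∈ B.degreeSpace (j + d)) ?_ ?_ ?_ ?_ hv
  · rintro _ ⟨b, rfl, rfl⟩
    exact hT b
  · simp
  · intro x y _ _ hx hy
    rw [map_add]
    exact add_mem hx hy
  · intro a x _ hx
    rw [map_smul]
    exact Submodule.smul_mem _ _ hx

variable {φ : LieAlgebra.SpecialLinear.sl (Fin 2) k →ₗ⁅k⁆ g}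

theorem lie_h_simple (i j : Fin n) :
    ⁅B.basis (.inl j), B.basis (.inr (simpleRoot A i))⁆ =
      (A i j : k) • B.basis (.inr (simpleRoot A i)) := by
  rw [B.lie_h_x, Int.cast_smul_eq_zsmul]
  simp [simpleRoot, pairSimpleCoroot_single]

theorem lie_h_negSimple (i j : Fin n) :
    ⁅B.basis (.inl j), B.basis (.inr (negSimpleRoot A i))⁆ =
      -((A i j : k) • B.basis (.inr (negSimpleRoot A i))) := by
  rw [B.lie_h_x, Int.cast_smul_eq_zsmul]
  simp [negSimpleRoot, pairSimpleCoroot_neg, pairSimpleCoroot_single]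

/-- Compare the coefficients of `X_{α_i}` in `[H, X] = 2X`. This replaces a summation over all
positive coroots. -/
theorem sum_mul_twoRhoCheck (hφ : B.IsPrincipal φ) (i : Fin n) :
    ∑ j, (A i j : k) * (twoRhoCheck A j : k) = 2 := by
  have h1 := lie_H_X hφ
  have h2 : ∀ i, ⁅B.principalH, B.basis (.inr (simpleRoot A i))⁆ =
      (∑ j, (A i j : k) * (twoRhoCheck A j : k)) • B.basis (.inr (simpleRoot A i)) := by
    intro i
    rw [principalH, sum_lie, Finset.sum_smul]
    refine Finset.sum_congr rfl fun j _ => ?_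
    rw [← Int.cast_smul_eq_zsmul k, smul_lie, lie_h_simple, smul_smul, mul_comm]
  have h3 : LinearIndependent k fun i => B.basis (.inr (simpleRoot A i)) :=
    B.basis.linearIndependent.comp (fun i => Sum.inr (simpleRoot A i))
      (Sum.inr_injective.comp (simpleRoot_injective A))
  rw [principalX, lie_sum, Finset.smul_sum, ← sub_eq_zero, ← Finset.sum_sub_distrib] at h1
  simp only [h2, ← sub_smul] at h1
  exact sub_eq_zero.mp (Fintype.linearIndependent_iff.mp h3 _ h1 i)

/-- Both vectors solve `A x = (2, …, 2)` over `k`, and `det A` is nonzero in `k`. -/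
theorem twoRhoCheck_cast (D : PrincipalDatum A E h c U l) (hφ : B.IsPrincipal φ) (ℓ : ℕ)
    [CharP k ℓ] (hℓ : ℓ = 0 ∨ h ≤ ℓ) (i : Fin n) : (twoRhoCheck A i : k) = c i := by
  have h1 := D.two_lt
  have h2 : (A.map (Int.cast : ℤ → k)).det ≠ 0 := by
    have := intCast_ne_zero_of_dvd_factorial (k := k) ℓ (by omega) D.det_dvd
    rwa [Int.cast_det] at this
  have h3 : (A.map (Int.cast : ℤ → k)).mulVec (fun j => (twoRhoCheck A j : k) - c j) = 0 := by
    funext i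
    have h4 := B.sum_mul_twoRhoCheck hφ i
    have h5 : ∑ j, (A i j : k) * (c j : k) = 2 := by
      have := congrArg (fun z : ℤ => (z : k)) (D.sum_mul_c i)
      simpa using this
    simp only [Matrix.mulVec, dotProduct, Matrix.map_apply, mul_sub, Finset.sum_sub_distrib, h4, h5,
      sub_self, Pi.zero_apply]
  exact sub_eq_zero.mp (congrFun (Matrix.eq_zero_of_mulVec_eq_zero h2 h3) i)

theorem adX_mem (D : PrincipalDatum A E h c U l) {j : ℤ} {v : g} (hv : v ∈ B.degreeSpace j) :
    B.adX v ∈ B.degreeSpace (j + 1) := by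
  refine B.map_mem_degreeSpace (fun b => ?_) hv
  rw [adX_apply, principalX, sum_lie]
  refine sum_mem fun i _ => ?_
  simpa using B.lie_root_basis_mem D (simpleRoot A i) b

theorem adY_mem (D : PrincipalDatum A E h c U l) {j : ℤ} {v : g} (hv : v ∈ B.degreeSpace j) :
    B.adY v ∈ B.degreeSpace (j - 1) := by
  refine B.map_mem_degreeSpace (d := -1) (fun b => ?_) hv
  rw [adY_apply, principalY, sum_lie]
  refine sum_mem fun i _ => ?_
  rw [← Int.cast_smul_eq_zsmul k, smul_lie]
  refine Submodule.smul_mem _ _ ?_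
  simpa using B.lie_root_basis_mem D (negSimpleRoot A i) b

theorem lie_H_basis (hφ : B.IsPrincipal φ) (b : Fin n ⊕ Root A) :
    ⁅B.principalH, B.basis b⁆ = (2 * (basisDegree A b : k)) • B.basis b := by
  rcases b with i | α
  · rw [principalH, sum_lie]
    simp only [← Int.cast_smul_eq_zsmul k, smul_lie, B.lie_h_h]
    simp [basisDegree]
  · have h1 : ⁅B.principalH, B.basis (.inr α)⁆ =
        (∑ j, (twoRhoCheck A j : k) * (pairSimpleCoroot A α.root j : k)) • B.basis (.inr α) := by
      rw [principalH, sum_lie, Finset.sum_smul]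
      refine Finset.sum_congr rfl fun j _ => ?_
      rw [← Int.cast_smul_eq_zsmul k, smul_lie, B.lie_h_x, ← Int.cast_smul_eq_zsmul k, smul_smul]
    rw [h1]
    congr 1
    simp only [pairSimpleCoroot, basisDegree, Sum.elim_inr, Root.height, Int.cast_sum, Int.cast_mul,
      Finset.mul_sum]
    rw [Finset.sum_comm]
    refine Finset.sum_congr rfl fun i _ => ?_
    rw [← B.sum_mul_twoRhoCheck hφ i, Finset.sum_mul]
    exact Finset.sum_congr rfl fun j _ => by ring

theorem adH_of_mem (hφ : B.IsPrincipal φ) {j : ℤ} {v : g} (hv : v ∈ B.degreeSpace j) :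
    B.adH v = (2 * (j : k)) • v := by
  refine Submodule.span_induction (p := fun v _ => B.adH v = (2 * (j : k)) • v) ?_ ?_ ?_ ?_ hv
  · rintro _ ⟨b, rfl, rfl⟩
    exact B.lie_H_basis hφ b
  · simp
  · intro x y _ _ hx hy
    rw [map_add, hx, hy, smul_add]
  · intro a x _ hx
    rw [map_smul, hx, smul_comm]

theorem adX_adY (hφ : B.IsPrincipal φ) (v : g) :
    B.adX (B.adY v) = B.adY (B.adX v) + B.adH v := by
  rw [adX_apply, adY_apply, adX_apply, adY_apply, adH_apply, ← lie_X_Y hφ, lie_lie]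
  abel

theorem adH_adX (hφ : B.IsPrincipal φ) (v : g) :
    B.adH (B.adX v) = B.adX (B.adH v) + (2 : k) • B.adX v := by
  simp only [adX_apply, adH_apply]
  rw [← smul_lie, ← lie_H_X hφ, lie_lie]
  abel

theorem adH_adY (hφ : B.IsPrincipal φ) (v : g) :
    B.adH (B.adY v) = B.adY (B.adH v) + (-2 : k) • B.adY v := by
  simp only [adY_apply, adH_apply]
  rw [← smul_lie, ← lie_H_Y hφ, lie_lie]
  abel

theorem isGradedPair (D : PrincipalDatum A E h c U l) (hφ : B.IsPrincipal φ) :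
    IsGradedPair B.degreeSpace B.adX B.adY where
  e_mem := B.adX_mem D
  f_mem := B.adY_mem D
  comm hv := by rw [B.adX_adY hφ, B.adH_of_mem hφ hv]

/-- The parametrization of the Cartan subalgebra by coordinates. -/
noncomputable def cartanMap : (Fin n → k) →ₗ[k] g :=
  Fintype.linearCombination k fun i => B.basis (.inl i)

/-- The parametrization of the sum of the negative simple root spaces by coordinates. -/
noncomputable def negSimpleMap : (Fin n → k) →ₗ[k] g :=
  Fintype.linearCombination k fun i => B.basis (.inr (negSimpleRoot A i))

theorem cartanMap_apply (u : Fin n → k) : B.cartanMap u = ∑ i, u i • B.basis (.inl i) := rfl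

theorem negSimpleMap_apply (u : Fin n → k) :
    B.negSimpleMap u = ∑ i, u i • B.basis (.inr (negSimpleRoot A i)) := rfl

theorem range_cartanMap : LinearMap.range B.cartanMap = B.cartanSpace :=
  Fintype.range_linearCombination k _

theorem range_negSimpleMap : LinearMap.range B.negSimpleMap = B.negSimpleSpace :=
  Fintype.range_linearCombination k _

theorem cartanMap_injective : Function.Injective B.cartanMap :=
  (B.basis.linearIndependent.comp _ Sum.inl_injective).fintypeLinearCombination_injective

theorem repr_negSimpleMap (u : Fin n → k) (i : Fin n) :
    B.basis.repr (B.negSimpleMap u) (.inr (negSimpleRoot A i)) = u i := by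
  classical
  simp only [negSimpleMap_apply, map_sum, map_smul, Module.Basis.repr_self, Finsupp.coe_finsetSum,
    Finset.sum_apply, Finsupp.smul_apply, Finsupp.single_apply, Sum.inr.injEq,
    (negSimpleRoot_injective A).eq_iff]
  simp

theorem cartanMap_mem (u : Fin n → k) : B.cartanMap u ∈ B.degreeSpace 0 := by
  rw [cartanMap_apply]
  exact sum_mem fun i _ => Submodule.smul_mem _ _ (B.basis_mem_degreeSpace (.inl i))

theorem negSimpleSpace_le : B.negSimpleSpace ≤ B.degreeSpace (-1) := by
  refine Submodule.span_le.mpr ?_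
  rintro _ ⟨i, rfl⟩
  simpa [basisDegree] using B.basis_mem_degreeSpace (.inr (negSimpleRoot A i))

theorem exists_cartanMap_eq (D : PrincipalDatum A E h c U l) {v : g} (hv : v ∈ B.degreeSpace 0) :
    ∃ u, v = B.cartanMap u := by
  have h1 : B.degreeSpace 0 ≤ LinearMap.range B.cartanMap := by
    rw [range_cartanMap]
    refine Submodule.span_mono ?_
    rintro _ ⟨i | α, h1, rfl⟩
    · exact ⟨i, rfl⟩
    · exact absurd h1 (D.basisDegree_inr_ne_zero α)
  obtain ⟨u, rfl⟩ := h1 hv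
  exact ⟨u, rfl⟩

/-- `[X_{α_i}, X_{-α_j}] = δ_ij H_i`. This is why `L_m` and `t ∩ V_m` have the same coordinates. -/
theorem adX_negSimpleMap (D : PrincipalDatum A E h c U l) (u : Fin n → k) :
    B.adX (B.negSimpleMap u) = B.cartanMap u := by
  obtain ⟨o, L, hL, hb⟩ := D.exists_codes
  have h1 : ∀ i j, ⁅B.basis (.inr (simpleRoot A i)), B.basis (.inr (negSimpleRoot A j))⁆ =
      if i = j then B.basis (.inl j) else 0 := by
    intro i j
    split_ifs with hij
    · subst hij
      rw [B.lie_x_neg _ _ (by simp [simpleRoot, negSimpleRoot])]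
      simp [simpleRoot, Pi.single_apply]
    -- `α_i - α_j` has coordinates of both signs, so it is neither zero nor a root.
    · refine B.lie_x_x_zero _ _ (fun h0 => ?_) fun γ hγ => ?_
      · have := congrFun h0 i
        simp [simpleRoot, negSimpleRoot, hij] at this
      · have h2 := congrFun hγ i
        have h3 := congrFun hγ j
        simp only [simpleRoot, negSimpleRoot, Pi.add_apply, Pi.neg_apply, Pi.single_eq_same,
          Pi.single_eq_of_ne hij, Pi.single_eq_of_ne (Ne.symm hij)] at h2 h3
        rcases hL.nonneg_or_nonpos γ with h4 | h4
        · have := h4 j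
          simp [h3] at this
        · have := h4 i
          simp [h2] at this
  simp only [adX_apply, principalX, negSimpleMap_apply, cartanMap_apply, sum_lie, lie_sum, lie_smul,
    h1]
  simp

theorem adY_cartanMap (D : PrincipalDatum A E h c U l) (hφ : B.IsPrincipal φ) (ℓ : ℕ)
    [CharP k ℓ] (hℓ : ℓ = 0 ∨ h ≤ ℓ) (u : Fin n → k) :
    B.adY (B.cartanMap u) = B.negSimpleMap (cartanEnd A c k u) := by
  rw [adY_apply, principalY, negSimpleMap_apply, cartanMap_apply, sum_lie]
  refine Finset.sum_congr rfl fun i _ => ?_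
  rw [cartanEnd_apply, Finset.mul_sum, Finset.sum_smul, lie_sum]
  refine Finset.sum_congr rfl fun j _ => ?_
  rw [← Int.cast_smul_eq_zsmul k, smul_lie, lie_smul, ← lie_skew, lie_h_negSimple, neg_neg,
    smul_smul,
    smul_smul, B.twoRhoCheck_cast D hφ ℓ hℓ]
  congr 1
  ring

theorem adX_adY_cartanMap (D : PrincipalDatum A E h c U l) (hφ : B.IsPrincipal φ) (ℓ : ℕ)
    [CharP k ℓ] (hℓ : ℓ = 0 ∨ h ≤ ℓ) (u : Fin n → k) :
    B.adX (B.adY (B.cartanMap u)) = B.cartanMap (cartanEnd A c k u) := by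
  rw [B.adY_cartanMap D hφ ℓ hℓ, B.adX_negSimpleMap D]

theorem adY_adX_cartanMap (D : PrincipalDatum A E h c U l) (hφ : B.IsPrincipal φ) (ℓ : ℕ)
    [CharP k ℓ] (hℓ : ℓ = 0 ∨ h ≤ ℓ) (u : Fin n → k) :
    B.adY (B.adX (B.cartanMap u)) = B.cartanMap (cartanEnd A c k u) := by
  have h1 := (B.isGradedPair D hφ).comm (B.cartanMap_mem u)
  rw [B.adX_adY_cartanMap D hφ ℓ hℓ] at h1
  simpa using h1.symm

end ChevalleyBasis

/-! ### The matrix `N` over `k` and the lines `P_{2m}` -/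

section

open Polynomial

/-- Eigenvectors of the matrix `(c_i A_ij)` over `k` for the eigenvalues `m (m + 1)` are determined
by their coordinate at `l`. -/
def EigenvectorsDetermined {n : ℕ} (A : Matrix (Fin n) (Fin n) ℤ) (E : Finset ℕ) (c : Fin n → ℤ)
    (l : Fin n) (k : Type*) [Field k] : Prop :=
  ∀ m ∈ E, ∀ x : Fin n → k, cartanEnd A c k x = ((m : k) * (m + 1)) • x → x l = 0 → x = 0

/-- The vector `U m` over `k`. -/
def eigenvec {n : ℕ} (U : ℕ → Fin n → ℤ) (k : Type*) [Field k] (m : ℕ) : Fin n → k :=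
  fun i => (U m i : k)

namespace PrincipalDatum

variable {n : ℕ} {A : Matrix (Fin n) (Fin n) ℤ} {E : Finset ℕ} {h : ℕ} {c : Fin n → ℤ}
  {U : ℕ → Fin n → ℤ} {l : Fin n}

theorem cartanEnd_eigenvec (D : PrincipalDatum A E h c U l) (k : Type*) [Field k] {m : ℕ}
    (hm : m ∈ E) :
    cartanEnd A c k (eigenvec U k m) = ((m : k) * (m + 1)) • eigenvec U k m := by
  funext i
  have := congrArg (fun z : ℤ => (z : k)) (D.eigen m hm i)
  simpa [cartanEnd_apply, eigenvec] using this

theorem eigenvec_l_ne_zero (D : PrincipalDatum A E h c U l) {k : Type*} [Field k] (ℓ : ℕ)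
    [CharP k ℓ] (hℓ : ℓ = 0 ∨ h ≤ ℓ) {m : ℕ} (hm : m ∈ E) : eigenvec U k m l ≠ 0 := by
  have := D.two_lt
  exact intCast_ne_zero_of_dvd_factorial ℓ (by omega) (D.last_dvd m hm)

theorem eigenvalue_ne (D : PrincipalDatum A E h c U l) {k : Type*} [Field k] (ℓ : ℕ)
    [CharP k ℓ] (hℓ : ℓ = 0 ∨ h ≤ ℓ) {m : ℕ} (hm : m ∈ E) {a : ℕ} (ha : a < m) (haE : a ∉ E) :
    (a : k) * (a + 1) ≠ m * (m + 1) := by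
  have := D.two_lt
  have := intCast_ne_zero_of_dvd_factorial (k := k) ℓ (by omega) (D.casimir_dvd m hm a ha haE)
  push_cast at this
  exact (sub_ne_zero.mp this).symm

theorem eigenvalue_ne_zero (D : PrincipalDatum A E h c U l) {k : Type*} [Field k] (ℓ : ℕ)
    [CharP k ℓ] (hℓ : ℓ = 0 ∨ h ≤ ℓ) {m : ℕ} (hm : m ∈ E) : (m : k) * (m + 1) ≠ 0 := by
  have := D.two_lt
  have := intCast_ne_zero_of_dvd_factorial (k := k) ℓ (by omega) (D.eigenvalue_dvd m hm)
  push_cast at this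
  exact this

/-- The difference factors as `(m - a) (m + a + 1)`, and `m + a + 1 ≤ 2h - 2` for distinct
exponents. The bound `2h - 1` on `ℓ` enters here. -/
theorem eigenvalue_ne_of_mem (D : PrincipalDatum A E h c U l) {k : Type*} [Field k] (ℓ : ℕ)
    [CharP k ℓ] (hℓ : ℓ = 0 ∨ 2 * h - 1 ≤ ℓ) {m : ℕ} (hm : m ∈ E) {a : ℕ} (ha : a ∈ E)
    (ham : a ≠ m) : (a : k) * (a + 1) ≠ m * (m + 1) := by
  have := D.two_lt
  rcases lt_or_gt_of_ne ham with h1 | h1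
  · have := intCast_ne_zero_of_dvd_factorial (k := k) ℓ (by omega) (D.diff_dvd m hm a ha h1)
    push_cast at this
    exact (sub_ne_zero.mp this).symm
  · have := intCast_ne_zero_of_dvd_factorial (k := k) ℓ (by omega) (D.diff_dvd a ha m hm h1)
    push_cast at this
    exact sub_ne_zero.mp this

/-- Over `ℚ` the `n` eigenvectors have distinct eigenvalues, hence form a basis, and each is killed
by its own factor. -/
theorem aeval_casimirPoly_rat (D : PrincipalDatum A E h c U l) :
    aeval (cartanEnd A c ℚ) (casimirPoly ℚ E) = 0 := by
  classical
  have h1 : LinearIndependent ℚ fun m : E => eigenvec U ℚ m := by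
    refine Module.End.eigenvectors_linearIndependent' (cartanEnd A c ℚ)
      (fun m : E => ((m : ℕ) : ℚ) * ((m : ℕ) + 1)) ?_ _ fun m => ⟨?_, ?_⟩
    · intro a b hab
      exact by_contra fun hne => D.eigenvalue_ne_of_mem 0 (.inl rfl) b.2 a.2
        (fun h => hne (Subtype.ext h)) hab
    · exact Module.End.mem_eigenspace_iff.mpr (D.cartanEnd_eigenvec ℚ m.2)
    · exact fun h => D.eigenvec_l_ne_zero (k := ℚ) 0 (.inl rfl) m.2 (congrFun h l)
  have h2 : Fintype.card E = Module.finrank ℚ (Fin n → ℚ) := by simp [D.card]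
  have : Nonempty E := by
    by_contra hE
    rw [not_nonempty_iff] at hE
    rw [Fintype.card_eq_zero] at h2
    rw [Module.finrank_fin_fun] at h2
    exact (h2 ▸ l).elim0
  refine (basisOfLinearIndependentOfCardEqFinrank h1 h2).ext fun m => ?_
  rw [coe_basisOfLinearIndependentOfCardEqFinrank, casimirPoly,
    ← Finset.prod_erase_mul _ _ m.2, map_mul, Module.End.mul_apply, aeval_X_sub_C_apply,
    D.cartanEnd_eigenvec ℚ m.2, sub_self, map_zero, LinearMap.zero_apply]

theorem _root_.aeval_cartanEnd (A : Matrix (Fin n) (Fin n) ℤ) (c : Fin n → ℤ) (E : Finset ℕ)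
    (k : Type*) [Field k] : aeval (cartanEnd A c k) (casimirPoly k E) =
      Matrix.toLinAlgEquiv' ((Int.castRingHom k).mapMatrix
        (aeval (Matrix.of fun i j => c i * A i j) (∏ a ∈ E, (X - C ((a : ℤ) * (a + 1)))))) := by
  have h1 : cartanEnd A c k = Matrix.toLinAlgEquiv'
      ((Int.castRingHom k).mapMatrix (Matrix.of fun i j => c i * A i j)) := rfl
  have h2 : casimirPoly k E =
      (∏ a ∈ E, (X - C ((a : ℤ) * (a + 1)))).map (Int.castRingHom k) := by
    simp [casimirPoly, Polynomial.map_prod]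
  rw [h1, h2, Polynomial.map_aeval_eq_aeval_map (φ := Int.castRingHom k), ← AlgEquiv.coe_toAlgHom,
    Polynomial.aeval_algHom_apply]
  exact RingHom.ext_int _ _

/-- The rational identity is one between integer matrices, so it reduces to every field, including
those where eigenvalues collide and the eigenvectors need not form a basis. -/
theorem aeval_casimirPoly (D : PrincipalDatum A E h c U l) (k : Type*) [Field k] :
    aeval (cartanEnd A c k) (casimirPoly k E) = 0 := by
  have h1 := D.aeval_casimirPoly_rat
  rw [aeval_cartanEnd, map_eq_zero_iff _ (AlgEquiv.injective _)] at h1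
  have h0 := Matrix.map_injective (f := Int.castRingHom ℚ) Int.cast_injective
    (h1.trans (map_zero (Int.castRingHom ℚ).mapMatrix).symm)
  rw [aeval_cartanEnd, h0, map_zero, map_zero]

variable {k : Type*} [Field k] (ℓ : ℕ) [CharP k ℓ]

theorem eq_smul_eigenvec (D : PrincipalDatum A E h c U l) (hu : EigenvectorsDetermined A E c l k)
    (hℓ : ℓ = 0 ∨ h ≤ ℓ) {m : ℕ} (hm : m ∈ E) {x : Fin n → k}
    (hx : cartanEnd A c k x = ((m : k) * (m + 1)) • x) :
    x = (x l / eigenvec U k m l) • eigenvec U k m := by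
  refine sub_eq_zero.mp (hu m hm _ ?_ ?_)
  · rw [map_sub, map_smul, hx, D.cartanEnd_eigenvec k hm, smul_sub, smul_comm]
  · simp [D.eigenvec_l_ne_zero ℓ hℓ hm]

theorem finrank_ker_le_one (D : PrincipalDatum A E h c U l) (hu : EigenvectorsDetermined A E c l k)
    (hℓ : ℓ = 0 ∨ h ≤ ℓ) {m : ℕ} (hm : m ∈ E) :
    Module.finrank k
      (LinearMap.ker (aeval (cartanEnd A c k) (X - C ((m : k) * (m + 1))))) ≤ 1 := by
  have h1 : eigenvec U k m ∈
      LinearMap.ker (aeval (cartanEnd A c k) (X - C ((m : k) * (m + 1)))) := by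
    rw [LinearMap.mem_ker, aeval_X_sub_C_apply, D.cartanEnd_eigenvec k hm, sub_self]
  refine finrank_le_one ⟨_, h1⟩ fun ⟨w, hw⟩ => ?_
  rw [LinearMap.mem_ker, aeval_X_sub_C_apply, sub_eq_zero] at hw
  exact ⟨_, Subtype.ext (D.eq_smul_eigenvec ℓ hu hℓ hm hw).symm⟩

end PrincipalDatum

namespace ChevalleyBasis

variable {n : ℕ} {A : Matrix (Fin n) (Fin n) ℤ} {k g : Type*} [Field k] [LieRing g]
  [LieAlgebra k g] (B : ChevalleyBasis A k g) {E : Finset ℕ} {h : ℕ} {c : Fin n → ℤ}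
  {U : ℕ → Fin n → ℤ} {l : Fin n} {φ : LieAlgebra.SpecialLinear.sl (Fin 2) k →ₗ⁅k⁆ g}
  (ℓ : ℕ) [CharP k ℓ]

theorem finrank_degreeSpace_le' (D : PrincipalDatum A E h c U l) (i : ℕ) (s : ℤ)
    (hs : s = i ∨ s = -i) : Module.finrank k (B.degreeSpace s) ≤ (E.filter (i ≤ ·)).card := by
  rcases Nat.eq_zero_or_pos i with rfl | hi
  · obtain rfl : s = 0 := by simpa using hs
    have h1 : B.degreeSpace 0 ≤ LinearMap.range B.cartanMap := fun v hv => by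
      obtain ⟨u, rfl⟩ := B.exists_cartanMap_eq D hv
      exact ⟨u, rfl⟩
    have := B.finiteDimensional D
    refine (Submodule.finrank_mono h1).trans ((LinearMap.finrank_range_le _).trans ?_)
    simp [D.card]
  · exact B.finrank_degreeSpace_le D hi s hs

theorem adX_pow_surjective (D : PrincipalDatum A E h c U l) (hφ : B.IsPrincipal φ)
    (hu : EigenvectorsDetermined A E c l k) (hℓ : ℓ = 0 ∨ h ≤ ℓ) (i : ℕ) :
    (∀ v ∈ B.degreeSpace i, ∃ u, v = (B.adX ^ i) (B.cartanMap u)) ∧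
    (∀ v ∈ B.degreeSpace i, (B.adY ^ i) v = 0 → v = 0) ∧
      Module.finrank k (B.degreeSpace i) = (E.filter (i ≤ ·)).card := by
  have := B.finiteDimensional D
  exact (B.isGradedPair D hφ).surjective_and_injective B.cartanMap_mem B.cartanMap_injective
    (B.adY_adX_cartanMap D hφ ℓ hℓ) (by simp [D.card]) (D.aeval_casimirPoly k)
    (fun m hm a ha haE => D.eigenvalue_ne ℓ hℓ hm ha haE)
    (fun m hm => D.finrank_ker_le_one ℓ hu hℓ hm) i (B.finrank_degreeSpace_le' D i _ (.inl rfl))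

theorem adY_pow_surjective (D : PrincipalDatum A E h c U l) (hφ : B.IsPrincipal φ)
    (hu : EigenvectorsDetermined A E c l k) (hℓ : ℓ = 0 ∨ h ≤ ℓ) (i : ℕ) :
    (∀ v ∈ B.degreeSpace (-i), ∃ u, v = (B.adY ^ i) (B.cartanMap u)) ∧
    (∀ v ∈ B.degreeSpace (-i), (B.adX ^ i) v = 0 → v = 0) := by
  have := B.finiteDimensional D
  have h1 := (B.isGradedPair D hφ).symm.surjective_and_injective (by simpa using B.cartanMap_mem)
    B.cartanMap_injective
    (B.adX_adY_cartanMap D hφ ℓ hℓ) (by simp [D.card]) (D.aeval_casimirPoly k)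
    (fun m hm a ha haE => D.eigenvalue_ne ℓ hℓ hm ha haE)
    (fun m hm => D.finrank_ker_le_one ℓ hu hℓ hm) i (B.finrank_degreeSpace_le' D i _ (.inr rfl))
  exact ⟨h1.1, h1.2.1⟩

/-- The `ad H`-eigenvalue fixes the degree only modulo `ℓ`. Components of negative degree vanish
because `ad X` is injective there; for degrees `0 ≤ j < h`, `2j = 2m` in `k` forces `j = m`, as `ℓ`
is 0 or an odd prime `≥ h`. -/
theorem mem_centralizerEigenspace_iff (D : PrincipalDatum A E h c U l) (hφ : B.IsPrincipal φ)
    (hu : EigenvectorsDetermined A E c l k) (hℓ : ℓ = 0 ∨ h ≤ ℓ) {m : ℕ} (hm : m ∈ E) {p : g} :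
    p ∈ B.centralizerEigenspace m ↔ p ∈ B.degreeSpace m ∧ B.adX p = 0 := by
  have hmem : p ∈ B.centralizerEigenspace m ↔
      B.adX p = 0 ∧ B.adH p = (2 * (m : k)) • p := Iff.rfl
  rw [hmem]
  constructor
  · rintro ⟨h1, h2⟩
    refine ⟨?_, h1⟩
    have h3 : ∀ j, j ≠ (m : ℤ) → B.degreeProj j p = 0 := by
      intro j hj
      have hmem := B.degreeProj_mem j p
      have h4 : B.adX (B.degreeProj j p) = 0 := by
        rw [← B.degreeProj_comm (d := 1) (fun j v => B.adX_mem D) j p, h1, map_zero]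
      have h5 : (2 * (j : k)) • B.degreeProj j p = (2 * (m : k)) • B.degreeProj j p := by
        rw [← B.adH_of_mem hφ hmem, ← map_smul, ← h2]
        have := B.degreeProj_comm (T := B.adH) (d := 0) (fun j v hv => by
          rw [B.adH_of_mem hφ hv, add_zero]; exact Submodule.smul_mem _ _ hv) j p
        rw [← this, add_zero]
      by_cases hjh : (h : ℤ) ≤ |j|
      · rw [B.degreeProj_eq_zero D hjh, LinearMap.zero_apply]
      rw [not_le, abs_lt] at hjh
      rcases lt_or_ge j 0 with hj0 | hj0
      · obtain ⟨i, hi⟩ : ∃ i : ℕ, j = -((i + 1 : ℕ) : ℤ) := ⟨(-j - 1).toNat, by omega⟩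
        refine (B.adY_pow_surjective ℓ D hφ hu hℓ (i + 1)).2 _ (hi ▸ hmem) ?_
        rw [pow_succ, Module.End.mul_apply, h4, map_zero]
      · by_contra hne
        rw [← sub_eq_zero, ← sub_smul, smul_eq_zero, or_iff_left hne, ← mul_sub] at h5
        have h6 := D.two_lt
        have h7 := (D.pos_lt m hm).2
        have h8 : ((2 * (j - m) : ℤ) : k) = 0 := by push_cast; exact h5
        rw [CharP.intCast_eq_zero_iff k ℓ] at h8
        rcases CharP.char_is_prime_or_zero k ℓ with hp | rfl
        · rcases (Nat.prime_iff_prime_int.mp hp).dvd_or_dvd h8 with h9 | h9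
          · have := Int.le_of_dvd (by norm_num) h9
            have := hp.pos
            omega
          · have := Int.eq_zero_of_abs_lt_dvd h9 (by rw [abs_lt]; have := hp.pos; omega)
            omega
        · rw [Nat.cast_zero, zero_dvd_iff] at h8
          omega
    have h4 := B.sum_degreeProj D p
    rw [Finset.sum_eq_single_of_mem (m : ℤ)] at h4
    · rw [← h4]
      exact B.degreeProj_mem _ _
    · have := D.pos_lt m hm
      rw [Finset.mem_Ioo]
      omega
    · exact fun j _ hj => h3 j hj
  · rintro ⟨h1, h2⟩
    refine ⟨h2, ?_⟩
    rw [B.adH_of_mem hφ h1]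
    simp

/-- `ad X` maps degree `m` onto degree `m + 1`, and the two dimensions, counts of exponents `≥ m`
and `≥ m + 1`, differ by one. -/
theorem finrank_centralizerEigenspace (D : PrincipalDatum A E h c U l) (hφ : B.IsPrincipal φ)
    (hu : EigenvectorsDetermined A E c l k) (hℓ : ℓ = 0 ∨ h ≤ ℓ) {m : ℕ} (hm : m ∈ E) :
    Module.finrank k (B.centralizerEigenspace m) = 1 := by
  have := B.finiteDimensional D
  have h1 := LinearMap.finrank_range_add_finrank_ker (B.adX.domRestrict (B.degreeSpace m))
  have h2 : LinearMap.range (B.adX.domRestrict (B.degreeSpace m)) =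
      B.degreeSpace ((m + 1 : ℕ) : ℤ) := by
    apply le_antisymm
    · rintro _ ⟨⟨v, hv⟩, rfl⟩
      exact_mod_cast B.adX_mem D hv
    · intro v hv
      obtain ⟨u, rfl⟩ := (B.adX_pow_surjective ℓ D hφ hu hℓ (m + 1)).1 v hv
      refine ⟨⟨(B.adX ^ m) (B.cartanMap u), ?_⟩, ?_⟩
      · simpa using (B.isGradedPair D hφ).e_pow_mem (B.cartanMap_mem u) m
      · rw [pow_succ']; rfl
  rw [h2, (B.adX_pow_surjective ℓ D hφ hu hℓ (m + 1)).2.2,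
    (B.adX_pow_surjective ℓ D hφ hu hℓ m).2.2] at h1
  have h3 : E.filter (m ≤ ·) = insert m (E.filter (m + 1 ≤ ·)) := by
    ext a
    simp only [Finset.mem_filter, Finset.mem_insert]
    constructor
    · rintro ⟨ha, hma⟩
      rcases hma.eq_or_lt with rfl | h
      · exact .inl rfl
      · exact .inr ⟨ha, h⟩
    · rintro (rfl | ⟨ha, hma⟩)
      · exact ⟨hm, le_rfl⟩
      · exact ⟨ha, by omega⟩
  rw [h3, Finset.card_insert_of_notMem (by simp)] at h1
  have h4 : B.centralizerEigenspace m =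
      (LinearMap.ker (B.adX.domRestrict (B.degreeSpace m))).map (B.degreeSpace m).subtype := by
    ext p
    rw [B.mem_centralizerEigenspace_iff ℓ D hφ hu hℓ hm]
    simp [and_comm]
  rw [h4, Submodule.finrank_map_subtype_eq]
  omega

end ChevalleyBasis

end

/-! ### The modules `V_m` and their intersections with degrees 0 and -1 -/

namespace ChevalleyBasis

variable {n : ℕ} {A : Matrix (Fin n) (Fin n) ℤ} {k g : Type*} [Field k] [LieRing g]
  [LieAlgebra k g] (B : ChevalleyBasis A k g) {E : Finset ℕ} {h : ℕ} {c : Fin n → ℤ}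
  {U : ℕ → Fin n → ℤ} {l : Fin n} {φ : LieAlgebra.SpecialLinear.sl (Fin 2) k →ₗ⁅k⁆ g}

theorem isSl2Stable_iff (hφ : B.IsPrincipal φ) {V : Submodule k g} :
    IsSl2Stable φ V ↔ ∀ v ∈ V, B.adX v ∈ V ∧ B.adY v ∈ V := by
  constructor
  · intro hV v hv
    have h1 := hV (slMatrix k 1 0 0) v hv
    have h2 := hV (slMatrix k 0 0 1) v hv
    rw [hφ] at h1 h2
    exact ⟨by simpa [slMatrix, adX_apply] using h1, by simpa [slMatrix, adY_apply] using h2⟩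
  · intro hV s v hv
    have h1 : B.adH v ∈ V := by
      rw [eq_sub_of_add_eq' (B.adX_adY hφ v).symm]
      exact sub_mem (hV _ (hV v hv).2).1 (hV _ (hV v hv).1).2
    rw [hφ, add_lie, add_lie, smul_lie, smul_lie, smul_lie]
    exact add_mem (add_mem (V.smul_mem _ (hV v hv).1) (V.smul_mem _ h1)) (V.smul_mem _ (hV v hv).2)

theorem isSl2Stable_summand (m : ℕ) : IsSl2Stable φ (B.summand φ m) := by
  intro s v hv
  rw [summand, Submodule.mem_sInf] at hv ⊢
  exact fun V hV => hV.1 s v (hv V hV)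

theorem centralizerEigenspace_le_summand (m : ℕ) :
    B.centralizerEigenspace m ≤ B.summand φ m :=
  le_sInf fun _ hV => hV.2

theorem adX_pow_mem_of_stable (hφ : B.IsPrincipal φ) {V : Submodule k g} (hV : IsSl2Stable φ V)
    {v : g} (hv : v ∈ V) (i : ℕ) : (B.adX ^ i) v ∈ V := by
  induction i with
  | zero => simpa using hv
  | succ i ih =>
    rw [pow_succ', Module.End.mul_apply]
    exact ((B.isSl2Stable_iff hφ).mp hV _ ih).1

theorem adY_pow_mem_of_stable (hφ : B.IsPrincipal φ) {V : Submodule k g} (hV : IsSl2Stable φ V)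
    {v : g} (hv : v ∈ V) (i : ℕ) : (B.adY ^ i) v ∈ V := by
  induction i with
  | zero => simpa using hv
  | succ i ih =>
    rw [pow_succ', Module.End.mul_apply]
    exact ((B.isSl2Stable_iff hφ).mp hV _ ih).2

/-- `p` is a vector that spans `P_{2m}`. -/
structure IsHighest (m : ℕ) (p : g) : Prop where
  ne_zero : p ≠ 0
  mem : p ∈ B.degreeSpace m
  adX_eq_zero : B.adX p = 0
  span_eq : B.centralizerEigenspace m = Submodule.span k {p}

variable {B} in
theorem IsHighest.adX_adY_pow (D : PrincipalDatum A E h c U l) (hφ : B.IsPrincipal φ) {m : ℕ}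
    {p : g} (hp : B.IsHighest m p) (i : ℕ) :
    B.adX ((B.adY ^ (i + 1)) p) = (((i : k) + 1) * (2 * m - i)) • (B.adY ^ i) p := by
  simpa using (B.isGradedPair D hφ).e_f_pow hp.mem hp.adX_eq_zero i

-- The vectors `Y^i p` already span a stable subspace: `ad X` returns `Y^{i+1} p` to a multiple of
-- `Y^i p`.
variable {B} in
theorem IsHighest.summand_eq (D : PrincipalDatum A E h c U l) (hφ : B.IsPrincipal φ) {m : ℕ}
    {p : g} (hp : B.IsHighest m p) :
    B.summand φ m = Submodule.span k (Set.range fun i : ℕ => (B.adY ^ i) p) := by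
  apply le_antisymm
  · refine sInf_le ⟨(B.isSl2Stable_iff hφ).mpr fun v hv => ?_, ?_⟩
    · refine Submodule.span_induction (p := fun v _ =>
        B.adX v ∈ Submodule.span k (Set.range fun i : ℕ => (B.adY ^ i) p) ∧
        B.adY v ∈ Submodule.span k (Set.range fun i : ℕ => (B.adY ^ i) p)) ?_ ?_ ?_ ?_ hv
      · rintro _ ⟨i, rfl⟩
        refine ⟨?_, Submodule.subset_span ⟨i + 1, by simp only [pow_succ']; rfl⟩⟩
        rcases i with _ | i
        · simp [hp.adX_eq_zero]
        · simp only [hp.adX_adY_pow D hφ]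
          exact Submodule.smul_mem _ _ (Submodule.subset_span ⟨i, rfl⟩)
      · simp
      · intro x y _ _ hx hy
        rw [map_add, map_add]
        exact ⟨add_mem hx.1 hy.1, add_mem hx.2 hy.2⟩
      · intro a x _ hx
        rw [map_smul, map_smul]
        exact ⟨Submodule.smul_mem _ _ hx.1, Submodule.smul_mem _ _ hx.2⟩
    · rw [hp.span_eq, Submodule.span_singleton_le_iff_mem]
      exact Submodule.subset_span ⟨0, rfl⟩
  · rw [Submodule.span_le]
    rintro _ ⟨i, rfl⟩
    refine B.adY_pow_mem_of_stable hφ (B.isSl2Stable_summand m)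
      (B.centralizerEigenspace_le_summand m ?_) i
    rw [hp.span_eq]
    exact Submodule.mem_span_singleton_self p

-- The spanning vectors `Y^a p` lie in distinct degrees, so projecting to one degree leaves at most
-- one of them.
variable {B} in
theorem IsHighest.eq_smul_of_mem (D : PrincipalDatum A E h c U l) (hφ : B.IsPrincipal φ) {m : ℕ}
    {p : g} (hp : B.IsHighest m p) {v : g} (hv : v ∈ B.summand φ m) {i : ℕ} {j : ℤ}
    (hj : j = m - i) (hvj : v ∈ B.degreeSpace j) : v ∈ Submodule.span k {(B.adY ^ i) p} := by
  have h1 : B.degreeProj j v ∈ Submodule.span k {(B.adY ^ i) p} := by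
    rw [hp.summand_eq D hφ] at hv
    refine Submodule.span_induction
      (p := fun v _ => B.degreeProj j v ∈ Submodule.span k {(B.adY ^ i) p}) ?_ ?_ ?_ ?_ hv
    · rintro _ ⟨a, rfl⟩
      simp only [B.degreeProj_of_mem ((B.isGradedPair D hφ).f_pow_mem hp.mem a)]
      split_ifs with h
      · obtain rfl : a = i := by omega
        exact Submodule.mem_span_singleton_self _
      · exact zero_mem _
    · simp
    · intro x y _ _ hx hy
      rw [map_add]
      exact add_mem hx hy
    · intro a x _ hx
      rw [map_smul]
      exact Submodule.smul_mem _ _ hx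
  rwa [B.degreeProj_of_mem hvj, if_pos rfl] at h1

variable (ℓ : ℕ) [CharP k ℓ]

theorem exists_isHighest (D : PrincipalDatum A E h c U l) (hφ : B.IsPrincipal φ)
    (hu : EigenvectorsDetermined A E c l k) (hℓ : ℓ = 0 ∨ h ≤ ℓ) {m : ℕ} (hm : m ∈ E) :
    ∃ p, B.IsHighest m p := by
  have h1 := B.finrank_centralizerEigenspace ℓ D hφ hu hℓ hm
  obtain ⟨⟨p, hp⟩, hp0, hspan⟩ := finrank_eq_one_iff'.mp h1
  have h2 := (B.mem_centralizerEigenspace_iff ℓ D hφ hu hℓ hm).mp hp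
  refine ⟨p, fun h => hp0 (Subtype.ext h), h2.1, h2.2, le_antisymm (fun w hw => ?_) ?_⟩
  · obtain ⟨a, ha⟩ := hspan ⟨w, hw⟩
    exact Submodule.mem_span_singleton.mpr ⟨a, congrArg Subtype.val ha⟩
  · rwa [Submodule.span_singleton_le_iff_mem]

-- `X Y^{m+1} p = m (m + 1) Y^m p`, so `Y^m p ∈ t` is an eigenvector of `N`, hence a multiple of `U
-- m`. One more application of `ad Y` applies `N` to its coordinates.
variable {B} in
theorem IsHighest.exists_adY_pow_eq (D : PrincipalDatum A E h c U l) (hφ : B.IsPrincipal φ)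
    (hu : EigenvectorsDetermined A E c l k) (hℓ : ℓ = 0 ∨ h ≤ ℓ) {m : ℕ} (hm : m ∈ E) {p : g}
    (hp : B.IsHighest m p) : ∃ a : k, a ≠ 0 ∧
      (B.adY ^ m) p = a • B.cartanMap (eigenvec U k m) ∧
      (B.adY ^ (m + 1)) p = (a * (m * (m + 1))) • B.negSimpleMap (eigenvec U k m) := by
  have h1 : (B.adY ^ m) p ∈ B.degreeSpace 0 := by
    simpa using (B.isGradedPair D hφ).f_pow_mem hp.mem m
  obtain ⟨u, hu1⟩ := B.exists_cartanMap_eq D h1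
  have h2 := hp.adX_adY_pow D hφ m
  have h3 : cartanEnd A c k u = ((m : k) * (m + 1)) • u := by
    apply B.cartanMap_injective
    rw [← B.adX_adY_cartanMap D hφ ℓ hℓ, ← hu1, map_smul, ← hu1, ← Module.End.mul_apply B.adY,
      ← pow_succ',
      h2]
    congr 1
    ring
  have h4 := D.eq_smul_eigenvec ℓ hu hℓ hm h3
  set a := u l / eigenvec U k m l
  have h6 : (B.adY ^ m) p = a • B.cartanMap (eigenvec U k m) := by rw [hu1, ← map_smul, ← h4]
  refine ⟨a, fun ha => ?_, h6, ?_⟩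
  · rw [ha, zero_smul] at h6
    -- `(ad Y)^m` is injective on degree `m`, so `Y^m p ≠ 0`.
    exact hp.ne_zero ((B.adX_pow_surjective ℓ D hφ hu hℓ m).2.1 p hp.mem h6)
  · rw [pow_succ', Module.End.mul_apply, h6, map_smul, B.adY_cartanMap D hφ ℓ hℓ,
      D.cartanEnd_eigenvec k hm, map_smul, smul_smul]

theorem span_singleton_smul_of_ne_zero {V : Type*} [AddCommGroup V] [Module k V] {a : k}
    (ha : a ≠ 0) (v : V) : Submodule.span k {a • v} = Submodule.span k {v} :=
  Submodule.span_singleton_smul_eq ha.isUnit v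

theorem summand_inf_negSimpleSpace (D : PrincipalDatum A E h c U l) (hφ : B.IsPrincipal φ)
    (hu : EigenvectorsDetermined A E c l k) (hℓ : ℓ = 0 ∨ h ≤ ℓ) {m : ℕ} (hm : m ∈ E) :
    B.summand φ m ⊓ B.negSimpleSpace =
      Submodule.span k {B.negSimpleMap (eigenvec U k m)} := by
  obtain ⟨p, hp⟩ := B.exists_isHighest ℓ D hφ hu hℓ hm
  obtain ⟨a, ha, -, h2⟩ := hp.exists_adY_pow_eq ℓ D hφ hu hℓ hm
  rw [← span_singleton_smul_of_ne_zero
    (mul_ne_zero ha (D.eigenvalue_ne_zero ℓ hℓ hm (k := k))), ← h2]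
  refine le_antisymm (fun v hv => hp.eq_smul_of_mem D hφ hv.1 (j := -1) (by push_cast; ring)
    (B.negSimpleSpace_le hv.2)) ?_
  rw [Submodule.span_singleton_le_iff_mem]
  refine ⟨?_, ?_⟩
  · rw [hp.summand_eq D hφ]
    exact Submodule.subset_span ⟨m + 1, rfl⟩
  · rw [h2, ← range_negSimpleMap]
    exact Submodule.smul_mem _ _ ⟨_, rfl⟩

theorem cartanMap_mem_summand (D : PrincipalDatum A E h c U l) (hφ : B.IsPrincipal φ)
    (hu : EigenvectorsDetermined A E c l k) (hℓ : ℓ = 0 ∨ h ≤ ℓ) {m : ℕ} (hm : m ∈ E) :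
    B.cartanMap (eigenvec U k m) ∈ B.summand φ m := by
  obtain ⟨p, hp⟩ := B.exists_isHighest ℓ D hφ hu hℓ hm
  obtain ⟨a, ha, h1, -⟩ := hp.exists_adY_pow_eq ℓ D hφ hu hℓ hm
  rw [← Submodule.smul_mem_iff _ ha, ← h1, hp.summand_eq D hφ]
  exact Submodule.subset_span ⟨m, rfl⟩

theorem negSimpleMap_eigenvec_ne_zero (D : PrincipalDatum A E h c U l) (hℓ : ℓ = 0 ∨ h ≤ ℓ)
    {m : ℕ} (hm : m ∈ E) : B.negSimpleMap (eigenvec U k m) ≠ 0 := by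
  intro h0
  have h1 := B.repr_negSimpleMap (eigenvec U k m) l
  rw [h0, map_zero, Finsupp.zero_apply] at h1
  exact D.eigenvec_l_ne_zero ℓ hℓ hm h1.symm

theorem finrank_summand_inf_negSimpleSpace (D : PrincipalDatum A E h c U l) (hφ : B.IsPrincipal φ)
    (hu : EigenvectorsDetermined A E c l k) (hℓ : ℓ = 0 ∨ h ≤ ℓ) {m : ℕ} (hm : m ∈ E) :
    Module.finrank k ↥(B.summand φ m ⊓ B.negSimpleSpace) = 1 := by
  rw [B.summand_inf_negSimpleSpace ℓ D hφ hu hℓ hm,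
    finrank_span_singleton (B.negSimpleMap_eigenvec_ne_zero ℓ D hℓ hm)]

/-- Turns the geometric question into arithmetic of the integers `U m i`. -/
theorem projNegRootNonzero_iff (D : PrincipalDatum A E h c U l) (hφ : B.IsPrincipal φ)
    (hu : EigenvectorsDetermined A E c l k) (hℓ : ℓ = 0 ∨ h ≤ ℓ) {m : ℕ} (hm : m ∈ E)
    (i : Fin n) :
    B.ProjNegRootNonzero (B.summand φ m ⊓ B.negSimpleSpace) i ↔ (U m i : k) ≠ 0 := by
  rw [B.summand_inf_negSimpleSpace ℓ D hφ hu hℓ hm, ProjNegRootNonzero]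
  constructor
  · rintro ⟨v, hv, h1⟩ h2
    obtain ⟨a, rfl⟩ := Submodule.mem_span_singleton.mp hv
    rw [map_smul, Finsupp.smul_apply, repr_negSimpleMap] at h1
    exact h1 (by rw [eigenvec, h2, smul_zero])
  · intro h1
    exact ⟨_, Submodule.mem_span_singleton_self _, by rwa [repr_negSimpleMap]⟩

/-- Since `α_i(H_i) = 2`, the component of `u ∈ t` along `H_i` is `α_i(u) / 2`. For `u = U m` the
eigenvector equation gives `c_i α_i(u) = m (m + 1) u_i`, so `α_i(u)` is nonzero as soon as `u_i` is.
-/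
theorem projCorootNonzero (D : PrincipalDatum A E h c U l) (hφ : B.IsPrincipal φ)
    (hu : EigenvectorsDetermined A E c l k) (hℓ : ℓ = 0 ∨ h ≤ ℓ) {m : ℕ} (hm : m ∈ E)
    (i : Fin n) (hU : (U m i : k) ≠ 0) :
    B.ProjCorootNonzero (B.summand φ m ⊓ B.cartanSpace) i := by
  have h2 : (2 : k) ≠ 0 := by
    have := D.two_lt
    have h3 := intCast_ne_zero_of_dvd_factorial (k := k) ℓ (N := 2) (by omega) (a := 2) (r := 1)
      (by simp)
    exact_mod_cast h3
  obtain ⟨o, L, hL, -⟩ := D.exists_codes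
  set s : k := ∑ j, (A i j : k) * eigenvec U k m j with hs
  have h3 : s ≠ 0 := by
    intro h0
    have h4 := congrFun (D.cartanEnd_eigenvec k hm) i
    rw [cartanEnd_apply, ← hs, h0, mul_zero, Pi.smul_apply, smul_eq_mul] at h4
    exact mul_ne_zero (D.eigenvalue_ne_zero ℓ hℓ hm) hU h4.symm
  have h5 : ∀ u : Fin n → k, B.cartanMap u ∈ B.cartanSpace := fun u => by
    rw [← range_cartanMap]
    exact ⟨u, rfl⟩
  refine ⟨_, ⟨B.cartanMap_mem_summand ℓ D hφ hu hℓ hm, h5 _⟩,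
    B.cartanMap (eigenvec U k m) - (s / 2) • B.basis (.inl i), sub_mem (h5 _)
      (Submodule.smul_mem _ _ (Submodule.subset_span ⟨i, rfl⟩)), s / 2, ?_, div_ne_zero h3 h2,
    (sub_add_cancel _ _).symm⟩
  rw [sub_lie, smul_lie, lie_h_simple, cartanMap_apply, sum_lie, hL.diag, sub_eq_zero, smul_smul]
  simp only [smul_lie, lie_h_simple, smul_smul, ← Finset.sum_smul]
  congr 1
  rw [hs]
  push_cast
  rw [div_mul_cancel₀ _ h2]
  exact Finset.sum_congr rfl fun j _ => mul_comm _ _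

end ChevalleyBasis

/-! ### The Casimir operator and the direct sum decomposition -/

section

open Polynomial

namespace ChevalleyBasis

variable {n : ℕ} {A : Matrix (Fin n) (Fin n) ℤ} {k g : Type*} [Field k] [LieRing g]
  [LieAlgebra k g] (B : ChevalleyBasis A k g) {E : Finset ℕ} {h : ℕ} {c : Fin n → ℤ}
  {U : ℕ → Fin n → ℤ} {l : Fin n} {φ : LieAlgebra.SpecialLinear.sl (Fin 2) k →ₗ⁅k⁆ g}

/-- The action of the Casimir element of `sl₂`. -/
noncomputable def casimir : Module.End k g :=
  B.adY * B.adX + (4 : k)⁻¹ • (B.adH * B.adH + (2 : k) • B.adH)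

theorem casimir_apply (v : g) : B.casimir v =
    B.adY (B.adX v) + (4 : k)⁻¹ • (B.adH (B.adH v) + (2 : k) • B.adH v) := rfl

theorem casimir_adX (hφ : B.IsPrincipal φ) (h4 : (4 : k) ≠ 0) (v : g) :
    B.casimir (B.adX v) = B.adX (B.casimir v) := by
  simp only [casimir_apply, map_add, map_smul, B.adX_adY hφ, B.adH_adX hφ]
  match_scalars <;> field_simp <;> ring

theorem casimir_adY (hφ : B.IsPrincipal φ) (h4 : (4 : k) ≠ 0) (v : g) :
    B.casimir (B.adY v) = B.adY (B.casimir v) := by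
  simp only [casimir_apply, map_add, map_smul, B.adX_adY hφ, B.adH_adY hφ]
  match_scalars <;> field_simp <;> ring

theorem casimir_of_mem (hφ : B.IsPrincipal φ) (h4 : (4 : k) ≠ 0) {j : ℤ} {v : g}
    (hv : v ∈ B.degreeSpace j) :
    B.casimir v = B.adY (B.adX v) + ((j : k) * (j + 1)) • v := by
  rw [casimir_apply, B.adH_of_mem hφ hv, map_smul, B.adH_of_mem hφ hv]
  congr 1
  match_scalars
  field_simp
  ring

variable (ℓ : ℕ) [CharP k ℓ]

theorem casimir_adX_pow_cartanMap (D : PrincipalDatum A E h c U l) (hφ : B.IsPrincipal φ)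
    (hℓ : ℓ = 0 ∨ h ≤ ℓ) (h4 : (4 : k) ≠ 0) (i : ℕ) (u : Fin n → k) :
    B.casimir (((B.adX ^ i).comp B.cartanMap) u) =
      ((B.adX ^ i).comp B.cartanMap) (cartanEnd A c k u) := by
  simp only [LinearMap.comp_apply]
  induction i with
  | zero =>
    simp [B.casimir_of_mem hφ h4 (B.cartanMap_mem u), B.adY_adX_cartanMap D hφ ℓ hℓ]
  | succ i ih => rw [pow_succ', Module.End.mul_apply, B.casimir_adX hφ h4, ih]; rfl

theorem casimir_adY_pow_cartanMap (D : PrincipalDatum A E h c U l) (hφ : B.IsPrincipal φ)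
    (hℓ : ℓ = 0 ∨ h ≤ ℓ) (h4 : (4 : k) ≠ 0) (i : ℕ) (u : Fin n → k) :
    B.casimir (((B.adY ^ i).comp B.cartanMap) u) =
      ((B.adY ^ i).comp B.cartanMap) (cartanEnd A c k u) := by
  simp only [LinearMap.comp_apply]
  induction i with
  | zero =>
    simp [B.casimir_of_mem hφ h4 (B.cartanMap_mem u), B.adY_adX_cartanMap D hφ ℓ hℓ]
  | succ i ih => rw [pow_succ', Module.End.mul_apply, B.casimir_adY hφ h4, ih]; rfl

/-- Every homogeneous vector is reached from `t` by a power of `ad X` or `ad Y`. These commute with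
the Casimir operator, which on `t` is `N`, so polynomial identities for `N` carry over. -/
theorem exists_intertwine_eq (D : PrincipalDatum A E h c U l) (hφ : B.IsPrincipal φ)
    (hu : EigenvectorsDetermined A E c l k) (hℓ : ℓ = 0 ∨ h ≤ ℓ) (h4 : (4 : k) ≠ 0) {j : ℤ}
    {v : g} (hv : v ∈ B.degreeSpace j) :
    ∃ T : (Fin n → k) →ₗ[k] g, (∀ u, B.casimir (T u) = T (cartanEnd A c k u)) ∧
      (∃ u, v = T u) ∧
      ∀ V, IsSl2Stable φ V → ∀ u, B.cartanMap u ∈ V → T u ∈ V := by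
  rcases le_total 0 j with hj | hj
  · obtain ⟨i, rfl⟩ := Int.eq_ofNat_of_zero_le hj
    exact ⟨(B.adX ^ i).comp B.cartanMap, B.casimir_adX_pow_cartanMap ℓ D hφ hℓ h4 i,
      (B.adX_pow_surjective ℓ D hφ hu hℓ i).1 v hv,
      fun V hV u hu => B.adX_pow_mem_of_stable hφ hV hu i⟩
  · obtain ⟨i, hi⟩ := Int.eq_ofNat_of_zero_le (neg_nonneg.mpr hj)
    obtain rfl : j = -i := by rw [← hi, neg_neg]
    exact ⟨(B.adY ^ i).comp B.cartanMap, B.casimir_adY_pow_cartanMap ℓ D hφ hℓ h4 i,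
      (B.adY_pow_surjective ℓ D hφ hu hℓ i).1 v hv,
      fun V hV u hu => B.adY_pow_mem_of_stable hφ hV hu i⟩

theorem aeval_casimir_eq_zero (D : PrincipalDatum A E h c U l) (hφ : B.IsPrincipal φ)
    (hu : EigenvectorsDetermined A E c l k) (hℓ : ℓ = 0 ∨ h ≤ ℓ) (h4 : (4 : k) ≠ 0) :
    aeval B.casimir (casimirPoly k E) = 0 := by
  ext v
  rw [← B.sum_degreeProj D v, map_sum]
  refine (Finset.sum_eq_zero fun j _ => ?_).trans (LinearMap.zero_apply _).symm
  obtain ⟨T, hT, ⟨u, hTu⟩, -⟩ :=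
    B.exists_intertwine_eq ℓ D hφ hu hℓ h4 (B.degreeProj_mem j v)
  rw [hTu, aeval_apply_of_intertwine hT, D.aeval_casimirPoly, LinearMap.zero_apply, map_zero]

theorem isSl2Stable_ker_aeval (hφ : B.IsPrincipal φ) (h4 : (4 : k) ≠ 0) (p : k[X]) :
    IsSl2Stable φ (LinearMap.ker (aeval B.casimir p)) := by
  rw [B.isSl2Stable_iff hφ]
  intro v hv
  rw [LinearMap.mem_ker] at hv
  simp only [LinearMap.mem_ker]
  rw [aeval_apply_of_intertwine (B.casimir_adX hφ h4),
    aeval_apply_of_intertwine (B.casimir_adY hφ h4), hv]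
  simp

/-- A homogeneous vector `T u` in the kernel equals `T y` for a `y` in the `m (m + 1)`-eigenspace of
`N`, by the Bezout relation with the other factors. Such a `y` is a multiple of `U m`, which lies in
`V_m`. -/
theorem ker_casimir_eq (D : PrincipalDatum A E h c U l) (hφ : B.IsPrincipal φ)
    (hu : EigenvectorsDetermined A E c l k) (hℓ : ℓ = 0 ∨ 2 * h - 1 ≤ ℓ) (h4 : (4 : k) ≠ 0)
    {m : ℕ} (hm : m ∈ E) :
    LinearMap.ker (aeval B.casimir (casimirPoly k {m})) = B.summand φ m := by
  have hℓ' : ℓ = 0 ∨ h ≤ ℓ := by have := D.two_lt; omega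
  apply le_antisymm
  · intro v hv
    rw [LinearMap.mem_ker] at hv
    rw [← B.sum_degreeProj D v]
    refine sum_mem fun j _ => ?_
    have h1 : aeval B.casimir (casimirPoly k {m}) (B.degreeProj j v) = 0 := by
      have h2 : ∀ v, B.casimir (B.degreeProj j v) = B.degreeProj j (B.casimir v) := by
        intro v
        have := B.degreeProj_comm (T := B.casimir) (d := 0) (fun j v hv => by
          rw [B.casimir_of_mem hφ h4 hv, add_zero]
          refine add_mem ?_ (Submodule.smul_mem _ _ hv)
          simpa using B.adY_mem D (B.adX_mem D hv)) j v
        rw [← this, add_zero]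
      rw [aeval_apply_of_intertwine h2, hv, map_zero]
    obtain ⟨T, hT, ⟨u, hTu⟩, hV⟩ :=
      B.exists_intertwine_eq ℓ D hφ hu hℓ' h4 (B.degreeProj_mem j v)
    obtain ⟨a, b, hab⟩ : IsCoprime (casimirPoly k {m}) (casimirPoly k (E.erase m)) := by
      refine isCoprime_casimirPoly fun x hx y hy => ?_
      obtain rfl := Finset.mem_singleton.mp hx
      exact (D.eigenvalue_ne_of_mem ℓ hℓ hm (Finset.mem_of_mem_erase hy)
        (Finset.ne_of_mem_erase hy)).symm
    have h3 : B.degreeProj j v =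
        T (aeval (cartanEnd A c k) (b * casimirPoly k (E.erase m)) u) := by
      rw [← aeval_apply_of_intertwine hT, ← hTu, eq_sub_of_add_eq' hab, map_sub, map_one, map_mul,
        LinearMap.sub_apply, Module.End.mul_apply, h1, map_zero, sub_zero, Module.End.one_apply]
    rw [h3]
    refine hV _ (B.isSl2Stable_summand m) _ ?_
    set y := aeval (cartanEnd A c k) (b * casimirPoly k (E.erase m)) u with hy
    have h5 : cartanEnd A c k y = ((m : k) * (m + 1)) • y := by
      have h6 : casimirPoly k E = (X - C ((m : k) * (m + 1))) * casimirPoly k (E.erase m) :=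
        (Finset.mul_prod_erase _ _ hm).symm
      have h7 : (X - C ((m : k) * (m + 1))) * (b * casimirPoly k (E.erase m)) =
          b * casimirPoly k E := by rw [h6]; ring
      rw [← sub_eq_zero, ← aeval_X_sub_C_apply, hy, ← Module.End.mul_apply, ← map_mul, h7, map_mul,
        D.aeval_casimirPoly, mul_zero, LinearMap.zero_apply]
    rw [D.eq_smul_eigenvec ℓ hu hℓ' hm h5, map_smul]
    exact Submodule.smul_mem _ _ (B.cartanMap_mem_summand ℓ D hφ hu hℓ' hm)
  · refine sInf_le ⟨B.isSl2Stable_ker_aeval hφ h4 _, fun p hp => ?_⟩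
    obtain ⟨h1, h2⟩ := (B.mem_centralizerEigenspace_iff ℓ D hφ hu hℓ' hm).mp hp
    rw [LinearMap.mem_ker, casimirPoly, Finset.prod_singleton, aeval_X_sub_C_apply,
      B.casimir_of_mem hφ h4 h1, h2]
    simp

/-- The factor of `m` is coprime to the product of the others, and the full product annihilates `g`;
the two kernels are stable because the Casimir operator commutes with `sl₂`. -/
theorem exists_isCompl_summand (D : PrincipalDatum A E h c U l) (hφ : B.IsPrincipal φ)
    (hu : EigenvectorsDetermined A E c l k) (hℓ : ℓ = 0 ∨ 2 * h - 1 ≤ ℓ) {m : ℕ} (hm : m ∈ E) :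
    ∃ W : Submodule k g, IsSl2Stable φ W ∧ IsCompl (B.summand φ m) W := by
  have hℓ' : ℓ = 0 ∨ h ≤ ℓ := by have := D.two_lt; omega
  have h2 : (4 : k) ≠ 0 := by
    have := D.two_lt
    have h3 := intCast_ne_zero_of_dvd_factorial (k := k) ℓ (N := 4) (by omega) (a := 4) (r := 1)
      (by decide)
    exact_mod_cast h3
  have hcop : IsCoprime (casimirPoly k {m}) (casimirPoly k (E.erase m)) := by
    refine isCoprime_casimirPoly fun x hx y hy => ?_
    obtain rfl := Finset.mem_singleton.mp hx
    exact (D.eigenvalue_ne_of_mem ℓ hℓ hm (Finset.mem_of_mem_erase hy)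
      (Finset.ne_of_mem_erase hy)).symm
  refine ⟨LinearMap.ker (aeval B.casimir (casimirPoly k (E.erase m))),
    B.isSl2Stable_ker_aeval hφ h2 _, ?_⟩
  rw [← B.ker_casimir_eq ℓ D hφ hu hℓ h2 hm]
  refine ⟨Polynomial.disjoint_ker_aeval_of_isCoprime _ hcop, ?_⟩
  have h6 : casimirPoly k {m} * casimirPoly k (E.erase m) = casimirPoly k E := by
    rw [casimirPoly, Finset.prod_singleton]
    exact Finset.mul_prod_erase _ _ hm
  rw [codisjoint_iff, Polynomial.sup_ker_aeval_eq_ker_aeval_mul_of_coprime _ hcop, h6,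
    B.aeval_casimir_eq_zero ℓ D hφ hu hℓ' h2, LinearMap.ker_zero]

end ChevalleyBasis

end

/-! ### Identification with binary forms -/

section

open MvPolynomial

namespace ChevalleyBasis

variable {n : ℕ} {A : Matrix (Fin n) (Fin n) ℤ} {k g : Type*} [Field k] [LieRing g]
  [LieAlgebra k g] {B : ChevalleyBasis A k g} {E : Finset ℕ} {h : ℕ} {c : Fin n → ℤ}
  {U : ℕ → Fin n → ℤ} {l : Fin n} {φ : LieAlgebra.SpecialLinear.sl (Fin 2) k →ₗ⁅k⁆ g}

/-- The image of the monomial `x ^ a y ^ b` in the module generated by `p`. -/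
noncomputable def monomialImage (B : ChevalleyBasis A k g) (m : ℕ) (p : g) (a b : ℕ) : g :=
  -- With `p` in the role of `x^{2m}` and `Y` acting as `y ∂/∂x`, one has `Y^b x^{2m} = ((2m)! / a!)
  -- x^a y^b` for `a + b = 2m`; this is the inverse scalar.
  ((a.factorial : k) / ((2 * m).factorial : k)) • (B.adY ^ b) p

/-- The linear map `x ^ a y ^ b ↦ monomialImage B m p a b`. -/
noncomputable def symMap (B : ChevalleyBasis A k g) (m : ℕ) (p : g) :
    MvPolynomial (Fin 2) k →ₗ[k] g :=
  (basisMonomials (Fin 2) k).constr k fun s => B.monomialImage m p (s 0) (s 1)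

theorem symMap_monomial (m : ℕ) (p : g) (s : Fin 2 →₀ ℕ) (a : k) :
    B.symMap m p (monomial s a) = a • B.monomialImage m p (s 0) (s 1) := by
  have h1 : (monomial s a : MvPolynomial (Fin 2) k) = a • basisMonomials (Fin 2) k s := by
    simp [smul_monomial]
  rw [h1, map_smul, symMap, Module.Basis.constr_basis]

theorem symMap_X_mul_pderiv (m : ℕ) (p : g) (s : Fin 2 →₀ ℕ) (a : k) (i j : Fin 2) :
    B.symMap m p (X i * pderiv j (monomial s a)) = (a * s j) •
      B.monomialImage m p ((Finsupp.single i 1 + (s - Finsupp.single j 1) : Fin 2 →₀ ℕ) 0)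
        ((Finsupp.single i 1 + (s - Finsupp.single j 1) : Fin 2 →₀ ℕ) 1) := by
  rw [pderiv_monomial, X, monomial_mul, one_mul, symMap_monomial]

variable (ℓ : ℕ) [CharP k ℓ]

/-- The factors `(i + 1) (2m - i)` by which `ad X` undoes `ad Y` involve only positive integers at
most `2m`, invertible when `ℓ > 2m`. -/
theorem IsHighest.adY_pow_ne_zero (D : PrincipalDatum A E h c U l) (hφ : B.IsPrincipal φ)
    {m : ℕ} (hℓ : ℓ = 0 ∨ 2 * m < ℓ) {p : g} (hp : B.IsHighest m p) {i : ℕ} (hi : i ≤ 2 * m) :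
    (B.adY ^ i) p ≠ 0 := by
  induction i with
  | zero => simpa using hp.ne_zero
  | succ i ih =>
    intro h0
    have h1 := hp.adX_adY_pow D hφ i
    have h2 : (((i : k) + 1) * (2 * m - i)) = (((i + 1) * (2 * m - i) : ℕ) : k) := by
      rw [Nat.cast_mul, Nat.cast_sub (by omega)]
      push_cast
      ring
    rw [h0, map_zero, h2, eq_comm, smul_eq_zero, or_iff_left (ih (by omega)),
      CharP.cast_eq_zero_iff k ℓ] at h1
    rcases CharP.char_is_prime_or_zero k ℓ with hp | rfl
    · rcases hp.dvd_mul.mp h1 with h3 | h3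
      · have := Nat.le_of_dvd (by omega) h3
        have := hp.pos
        omega
      · have := Nat.le_of_dvd (by omega) h3
        have := hp.pos
        omega
    · rw [zero_dvd_iff, mul_eq_zero] at h1
      omega

/-- `ad X` kills `Y^{2m+1} p`, since the factor `2m - i` vanishes at `i = 2m`, while `(ad X)^{m+1}`
is injective in degree `-(m + 1)`. -/
theorem IsHighest.adY_pow_eq_zero (D : PrincipalDatum A E h c U l) (hφ : B.IsPrincipal φ)
    (hu : EigenvectorsDetermined A E c l k) (hℓ : ℓ = 0 ∨ h ≤ ℓ) {m : ℕ} {p : g}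
    (hp : B.IsHighest m p) : (B.adY ^ (2 * m + 1)) p = 0 := by
  have h1 := hp.adX_adY_pow D hφ (2 * m)
  have h2 : (B.adY ^ (2 * m + 1)) p ∈ B.degreeSpace (-((m + 1 : ℕ) : ℤ)) := by
    have := (B.isGradedPair D hφ).f_pow_mem hp.mem (2 * m + 1)
    rwa [show (m : ℤ) - ((2 * m + 1 : ℕ) : ℤ) = -((m + 1 : ℕ) : ℤ) by push_cast; ring] at this
  refine (B.adY_pow_surjective ℓ D hφ hu hℓ (m + 1)).2 _ h2 ?_
  rw [pow_succ, Module.End.mul_apply, h1]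
  simp

theorem factorial_cast_ne_zero {m : ℕ} (hℓ : ℓ = 0 ∨ 2 * m < ℓ) :
    ((2 * m).factorial : k) ≠ 0 := natCast_factorial_ne_zero ℓ hℓ

theorem IsHighest.adX_monomialImage (D : PrincipalDatum A E h c U l) (hφ : B.IsPrincipal φ)
    {m : ℕ} {p : g} (hp : B.IsHighest m p) {a b : ℕ} (hab : a + b = 2 * m) :
    B.adX (B.monomialImage m p a b) = (b : k) • B.monomialImage m p (a + 1) (b - 1) := by
  rw [monomialImage, map_smul]
  rcases b with _ | b
  · simp [hp.adX_eq_zero]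
  · rw [hp.adX_adY_pow D hφ, monomialImage, smul_smul, smul_smul, Nat.add_sub_cancel,
      Nat.factorial_succ]
    congr 1
    have h1 : (2 * (m : k)) = a + (b + 1) := by
      have := congrArg (fun z : ℕ => (z : k)) hab.symm
      simpa using this
    rw [h1]
    push_cast
    ring

theorem IsHighest.adY_monomialImage (D : PrincipalDatum A E h c U l) (hφ : B.IsPrincipal φ)
    (hu : EigenvectorsDetermined A E c l k) (hℓ : ℓ = 0 ∨ h ≤ ℓ)
    {m : ℕ} {p : g} (hp : B.IsHighest m p) {a b : ℕ} (hab : a + b = 2 * m) :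
    B.adY (B.monomialImage m p a b) = (a : k) • B.monomialImage m p (a - 1) (b + 1) := by
  rw [monomialImage, map_smul, ← Module.End.mul_apply, ← pow_succ']
  rcases a with _ | a
  · obtain rfl : b = 2 * m := by omega
    simp [hp.adY_pow_eq_zero ℓ D hφ hu hℓ]
  · rw [monomialImage, smul_smul, Nat.add_sub_cancel, Nat.factorial_succ]
    congr 1
    push_cast
    ring

theorem IsHighest.adH_monomialImage (D : PrincipalDatum A E h c U l) (hφ : B.IsPrincipal φ)
    {m : ℕ} {p : g} (hp : B.IsHighest m p) {a b : ℕ} (hab : a + b = 2 * m) :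
    B.adH (B.monomialImage m p a b) = ((a : k) - b) • B.monomialImage m p a b := by
  rw [monomialImage, map_smul, B.adH_of_mem hφ ((B.isGradedPair D hφ).f_pow_mem hp.mem b),
    smul_comm]
  congr 1
  have h1 : (2 * (m : k)) = a + b := by
    have := congrArg (fun z : ℕ => (z : k)) hab.symm
    simpa using this
  push_cast
  rw [mul_sub, h1]
  ring

theorem IsHighest.symMap_symAction_monomial (D : PrincipalDatum A E h c U l)
    (hφ : B.IsPrincipal φ) (hu : EigenvectorsDetermined A E c l k) (hℓ : ℓ = 0 ∨ h ≤ ℓ)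
    {m : ℕ} {p : g} (hp : B.IsHighest m p) (s : LieAlgebra.SpecialLinear.sl (Fin 2) k)
    {d : Fin 2 →₀ ℕ} (hd : d 0 + d 1 = 2 * m) (a : k) :
    B.symMap m p (∑ i, ∑ j, C (s.1 i j) * (X i * pderiv j (monomial d a))) =
      ⁅φ s, B.symMap m p (monomial d a)⁆ := by
  have hs : s.1 1 1 = -s.1 0 0 := by
    have h1 : Matrix.trace s.1 = 0 := s.2
    rw [Matrix.trace_fin_two] at h1
    exact (neg_eq_of_add_eq_zero_right h1).symm
  have hX := hp.adX_monomialImage D hφ hd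
  have hY := hp.adY_monomialImage ℓ D hφ hu hℓ hd
  have hH := hp.adH_monomialImage D hφ hd
  -- Truncated subtraction gives a wrong exponent only when `d 0 = 0`, where the coefficient
  -- vanishes; likewise for `d 1`.
  have h00 : (d 0 : k) • B.monomialImage m p (1 + (d 0 - 1)) (d 1) =
      (d 0 : k) • B.monomialImage m p (d 0) (d 1) := by
    rcases Nat.eq_zero_or_pos (d 0) with h0 | h0
    · simp [h0]
    · rw [Nat.add_sub_cancel' h0]
  have h11 : (d 1 : k) • B.monomialImage m p (d 0) (1 + (d 1 - 1)) =
      (d 1 : k) • B.monomialImage m p (d 0) (d 1) := by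
    rcases Nat.eq_zero_or_pos (d 1) with h0 | h0
    · simp [h0]
    · rw [Nat.add_sub_cancel' h0]
  rw [hφ, add_lie, add_lie, smul_lie, smul_lie, smul_lie, ← adX_apply, ← adY_apply, ← adH_apply,
    symMap_monomial, map_smul, map_smul, map_smul, hX, hY, hH]
  simp only [Fin.sum_univ_two, map_add, ← smul_eq_C_mul, map_smul, symMap_X_mul_pderiv, mul_smul,
    hs]
  simp only [Finsupp.add_apply, Finsupp.tsub_apply, Finsupp.single_eq_same, ne_eq, zero_ne_one,
    one_ne_zero, not_false_eq_true, Finsupp.single_eq_of_ne, zero_add, tsub_zero, h00, h11,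
    add_comm 1 (d 0), add_comm 1 (d 1)]
  module

end ChevalleyBasis

end

section

open MvPolynomial

theorem sum_eq_of_mem_support {k : Type*} [Field k] {N : ℕ} {q : MvPolynomial (Fin 2) k}
    (hq : q.IsHomogeneous N) {d : Fin 2 →₀ ℕ} (hd : d ∈ q.support) : d 0 + d 1 = N := by
  have h1 := hq (mem_support_iff.mp hd)
  have h2 : d.degree = N := by
    rw [← h1]
    exact DFunLike.congr_fun (Finsupp.degree_eq_weight_one (R := ℕ)) d
  rwa [Finsupp.degree_eq_sum, Fin.sum_univ_two] at h2

theorem finsupp_fin_two_ext {d e : Fin 2 →₀ ℕ} (h0 : d 0 = e 0) (h1 : d 1 = e 1) : d = e := by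
  ext i
  fin_cases i <;> assumption

namespace ChevalleyBasis

variable {n : ℕ} {A : Matrix (Fin n) (Fin n) ℤ} {k g : Type*} [Field k] [LieRing g]
  [LieAlgebra k g] {B : ChevalleyBasis A k g} {E : Finset ℕ} {h : ℕ} {c : Fin n → ℤ}
  {U : ℕ → Fin n → ℤ} {l : Fin n} {φ : LieAlgebra.SpecialLinear.sl (Fin 2) k →ₗ⁅k⁆ g}
  (ℓ : ℕ) [CharP k ℓ]

theorem IsHighest.symMap_symAction (D : PrincipalDatum A E h c U l)
    (hφ : B.IsPrincipal φ) (hu : EigenvectorsDetermined A E c l k) (hℓ : ℓ = 0 ∨ h ≤ ℓ)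
    {m : ℕ} {p : g} (hp : B.IsHighest m p) (s : LieAlgebra.SpecialLinear.sl (Fin 2) k)
    (q : homogeneousSubmodule (Fin 2) k (2 * m)) :
    B.symMap m p (symAction (2 * m) s.1 q).1 = ⁅φ s, B.symMap m p q.1⁆ := by
  classical
  have key : ∀ (S : Finset (Fin 2 →₀ ℕ)) (f : (Fin 2 →₀ ℕ) → k), (∀ d ∈ S, d 0 + d 1 = 2 * m) →
      B.symMap m p (∑ i, ∑ j, C (s.1 i j) * (X i * pderiv j (∑ d ∈ S, monomial d (f d)))) =
        ⁅φ s, B.symMap m p (∑ d ∈ S, monomial d (f d))⁆ := by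
    intro S f hS
    induction S using Finset.induction_on with
    | empty => simp
    | insert d S hd ih =>
      simp only [Finset.sum_insert hd, map_add, mul_add, Finset.sum_add_distrib, lie_add]
      simp only [← map_add, ← Finset.sum_add_distrib]
      rw [← ih fun e he => hS e (Finset.mem_insert_of_mem he),
        ← hp.symMap_symAction_monomial ℓ D hφ hu hℓ s (hS d (Finset.mem_insert_self _ _)) (f d),
        ← map_add, ← Finset.sum_add_distrib]
      simp only [← Finset.sum_add_distrib]
  have h1 := key q.1.support (fun d => coeff d q.1)
    fun d hd => sum_eq_of_mem_support q.2 hd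
  rwa [← as_sum] at h1

theorem IsHighest.symMap_eq_sum (m : ℕ) (p : g) (q : MvPolynomial (Fin 2) k) :
    B.symMap m p q = ∑ d ∈ q.support, coeff d q • B.monomialImage m p (d 0) (d 1) := by
  conv_lhs => rw [as_sum q]
  rw [map_sum]
  exact Finset.sum_congr rfl fun d _ => symMap_monomial _ _ _ _

/-- Distinct monomials of degree `2m` go to nonzero vectors in distinct degrees `m - b`, so their
coefficients can be read off separately. -/
theorem IsHighest.eq_zero_of_symMap_eq_zero (D : PrincipalDatum A E h c U l)
    (hφ : B.IsPrincipal φ) {m : ℕ} (hℓ : ℓ = 0 ∨ 2 * m < ℓ) {p : g} (hp : B.IsHighest m p)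
    {q : MvPolynomial (Fin 2) k} (hq : q.IsHomogeneous (2 * m)) (h0 : B.symMap m p q = 0) :
    q = 0 := by
  by_contra hne
  obtain ⟨d, hd⟩ := Finset.nonempty_of_ne_empty (mt support_eq_empty.mp hne)
  have hd2 := sum_eq_of_mem_support hq hd
  have h1 := congrArg (B.degreeProj ((m : ℤ) - d 1)) h0
  rw [IsHighest.symMap_eq_sum, map_sum, map_zero, Finset.sum_eq_single_of_mem d hd] at h1
  · rw [monomialImage, map_smul, map_smul,
      B.degreeProj_of_mem ((B.isGradedPair D hφ).f_pow_mem hp.mem (d 1)), if_pos rfl, smul_smul,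
      smul_eq_zero, or_iff_left (hp.adY_pow_ne_zero ℓ D hφ hℓ (by omega)), mul_eq_zero,
      or_iff_right (mem_support_iff.mp hd)] at h1
    exact div_ne_zero (natCast_factorial_ne_zero ℓ (by omega)) (factorial_cast_ne_zero ℓ hℓ) h1
  · intro e he hed
    rw [monomialImage, map_smul, map_smul,
      B.degreeProj_of_mem ((B.isGradedPair D hφ).f_pow_mem hp.mem (e 1)), if_neg, smul_zero,
      smul_zero]
    intro h2
    have he2 := sum_eq_of_mem_support hq he
    exact hed (finsupp_fin_two_ext (by omega) (by omega))

theorem isSymPower_summand (D : PrincipalDatum A E h c U l) (hφ : B.IsPrincipal φ)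
    (hu : EigenvectorsDetermined A E c l k) (hℓ : ℓ = 0 ∨ 2 * h - 1 ≤ ℓ) {m : ℕ} (hm : m ∈ E) :
    IsSymPower φ (2 * m) (B.summand φ m) := by
  have hm2 := D.pos_lt m hm
  have hℓ1 : ℓ = 0 ∨ h ≤ ℓ := by omega
  have hℓ2 : ℓ = 0 ∨ 2 * m < ℓ := by omega
  obtain ⟨p, hp⟩ := B.exists_isHighest ℓ D hφ hu hℓ1 hm
  have hmem : ∀ q : homogeneousSubmodule (Fin 2) k (2 * m),
      (B.symMap m p).domRestrict _ q ∈ B.summand φ m := by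
    intro q
    rw [LinearMap.domRestrict_apply, IsHighest.symMap_eq_sum, hp.summand_eq D hφ]
    refine sum_mem fun d _ => Submodule.smul_mem _ _ (Submodule.smul_mem _ _ ?_)
    exact Submodule.subset_span ⟨d 1, rfl⟩
  refine ⟨B.isSl2Stable_summand m, LinearEquiv.ofBijective
    (((B.symMap m p).domRestrict (homogeneousSubmodule (Fin 2) k (2 * m))).codRestrict _ hmem)
    ⟨?_, ?_⟩, fun s q => ?_⟩
  · rw [← LinearMap.ker_eq_bot, LinearMap.ker_eq_bot']
    intro q hq
    exact Subtype.ext (hp.eq_zero_of_symMap_eq_zero ℓ D hφ hℓ2 q.2 (congrArg Subtype.val hq))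
  · rw [← LinearMap.range_eq_top, eq_top_iff]
    rintro ⟨v, hv⟩ -
    have h1 : B.summand φ m ≤ LinearMap.range
        ((B.symMap m p).domRestrict (homogeneousSubmodule (Fin 2) k (2 * m))) := by
      rw [hp.summand_eq D hφ, Submodule.span_le]
      rintro _ ⟨i, rfl⟩
      simp only [SetLike.mem_coe]
      rcases le_or_gt i (2 * m) with hi | hi
      · have h2 : ((2 * m - i).factorial : k) ≠ 0 := natCast_factorial_ne_zero ℓ (by omega)
        -- The coefficient cancels the scalar in `monomialImage`, so the image is exactly `Y^i p`.
        refine ⟨⟨monomial (Finsupp.single 0 (2 * m - i) + Finsupp.single 1 i)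
          (((2 * m).factorial : k) / ((2 * m - i).factorial : k)),
          isHomogeneous_monomial _ (by
            rw [Finsupp.degree_eq_sum, Fin.sum_univ_two]
            simp [-Finsupp.single_tsub, hi])⟩, ?_⟩
        rw [LinearMap.domRestrict_apply, symMap_monomial, monomialImage, smul_smul]
        simp only [Finsupp.add_apply, Finsupp.single_eq_same, ne_eq, zero_ne_one, one_ne_zero,
          not_false_eq_true, Finsupp.single_eq_of_ne, zero_add, add_zero]
        rw [div_mul_div_cancel₀ h2, div_self (factorial_cast_ne_zero ℓ hℓ2), one_smul]
      · obtain ⟨j, rfl⟩ := Nat.exists_eq_add_of_lt hi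
        rw [show 2 * m + j + 1 = j + (2 * m + 1) by ring, pow_add, Module.End.mul_apply,
          hp.adY_pow_eq_zero ℓ D hφ hu hℓ1, map_zero]
        exact zero_mem _
    obtain ⟨q, hq⟩ := h1 hv
    exact ⟨q, Subtype.ext hq⟩
  · exact hp.symMap_symAction ℓ D hφ hu hℓ1 s q

/-- The image of `x^{2m}` is a nonzero vector of the line `P_{2m}`, so the submodule contains `V_m`;
the dimensions agree. -/
theorem eq_summand_of_isSymPower (D : PrincipalDatum A E h c U l) (hφ : B.IsPrincipal φ)
    (hu : EigenvectorsDetermined A E c l k) (hℓ : ℓ = 0 ∨ 2 * h - 1 ≤ ℓ) {m : ℕ} (hm : m ∈ E)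
    {W : Submodule k g} (hW : IsSymPower φ (2 * m) W) : W = B.summand φ m := by
  have hm2 := D.pos_lt m hm
  have hℓ1 : ℓ = 0 ∨ h ≤ ℓ := by omega
  have := B.finiteDimensional D
  obtain ⟨-, Ψ, -⟩ := isSymPower_summand ℓ D hφ hu hℓ hm
  obtain ⟨hst, Φ, hΦ⟩ := hW
  have hx : (X 0 ^ (2 * m) : MvPolynomial (Fin 2) k).IsHomogeneous (2 * m) := by
    simpa using (isHomogeneous_X k (0 : Fin 2)).pow (2 * m)
  set x : homogeneousSubmodule (Fin 2) k (2 * m) := ⟨X 0 ^ (2 * m), hx⟩ with hxdef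
  have hx0 : x ≠ 0 := fun h0 => pow_ne_zero (2 * m) (X_ne_zero (0 : Fin 2))
    (congrArg Subtype.val h0)
  have h1 : (Φ x : g) ∈ B.centralizerEigenspace m := by
    have he := hΦ (slMatrix k 1 0 0) x
    have hh := hΦ (slMatrix k 0 1 0) x
    have he1 : symAction (2 * m) (slMatrix k 1 0 0).1 x = 0 := by
      refine Subtype.ext ?_
      simp [symAction, slMatrix, hxdef, Fin.sum_univ_two, Derivation.leibniz_pow, pderiv_X]
    have hh1 : symAction (2 * m) (slMatrix k 0 1 0).1 x = (2 * (m : k)) • x := by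
      refine Subtype.ext ?_
      obtain ⟨r, hr⟩ : ∃ r, 2 * m = r + 1 := ⟨2 * m - 1, by omega⟩
      have hr2 : (2 * (m : k)) = r + 1 := by
        have := congrArg (fun z : ℕ => (z : k)) hr
        simpa using this
      simp [symAction, slMatrix, hxdef, Fin.sum_univ_two, Derivation.leibniz_pow, pderiv_X, hr, hr2,
        smul_eq_C_mul]
      ring
    rw [he1, hφ] at he
    rw [hh1, hφ] at hh
    exact ⟨by simpa [slMatrix] using he.symm, by simpa [slMatrix] using hh.symm⟩
  have h2 : (Φ x : g) ≠ 0 := fun h0 => hx0 (Φ.map_eq_zero_iff.mp (Subtype.ext h0))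
  have h3 : B.summand φ m ≤ W := by
    refine sInf_le ⟨hst, ?_⟩
    have h4 : B.centralizerEigenspace m = Submodule.span k {(Φ x : g)} := by
      refine (Submodule.eq_of_le_of_finrank_le ?_ ?_).symm
      · rwa [Submodule.span_singleton_le_iff_mem]
      · rw [B.finrank_centralizerEigenspace ℓ D hφ hu hℓ1 hm, finrank_span_singleton h2]
    rw [h4, Submodule.span_singleton_le_iff_mem]
    exact (Φ x).2
  exact (Submodule.eq_of_le_of_finrank_eq h3 ((Ψ.symm.trans Φ).finrank_eq)).symm

end ChevalleyBasis

end

/-! ### From divisibility by listed primes to projections -/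

namespace ChevalleyBasis

variable {n : ℕ} {A : Matrix (Fin n) (Fin n) ℤ} {k g : Type*} [Field k] [LieRing g]
  [LieAlgebra k g] {B : ChevalleyBasis A k g} {E : Finset ℕ} {h : ℕ} {c : Fin n → ℤ}
  {U : ℕ → Fin n → ℤ} {l : Fin n} {φ : LieAlgebra.SpecialLinear.sl (Fin 2) k →ₗ⁅k⁆ g}
  (ℓ : ℕ) [CharP k ℓ]

theorem intCast_ne_zero_of_dvd_prod {S : Finset ℕ} (hS : ∀ p ∈ S, p.Prime) (hℓ : ℓ ∉ S) {a : ℤ}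
    {r : ℕ} (ha : a ∣ ((∏ p ∈ S, p : ℕ) : ℤ) ^ r) : (a : k) ≠ 0 := by
  refine intCast_ne_zero_of_dvd ha ?_
  push_cast
  refine pow_ne_zero _ (Finset.prod_ne_zero_iff.mpr fun p hp => ?_)
  rw [Ne, CharP.cast_eq_zero_iff k ℓ]
  intro hdvd
  rcases CharP.char_is_prime_or_zero k ℓ with h1 | rfl
  · exact hℓ (((Nat.prime_dvd_prime_iff_eq h1 (hS p hp)).mp hdvd) ▸ hp)
  · exact (hS p hp).ne_zero (zero_dvd_iff.mp hdvd)

theorem zero_or_le_of_notMem {S : Finset ℕ} (k : Type*) [Field k] [CharP k ℓ]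
    (hS : ∀ p < h, p.Prime → p ∈ S) (hℓ : ℓ ∉ S) : ℓ = 0 ∨ h ≤ ℓ := by
  rcases CharP.char_is_prime_or_zero k ℓ with h1 | h1
  · exact .inr (not_lt.mp fun h2 => hℓ (hS ℓ h2 h1))
  · exact .inl h1

theorem symPower_and_lines (D : PrincipalDatum A E h c U l) (hφ : B.IsPrincipal φ)
    (hu : ℓ = 0 ∨ h ≤ ℓ → EigenvectorsDetermined A E c l k) :
    ((ℓ = 0 ∨ 2 * h - 1 ≤ ℓ) → ∀ m ∈ E,
      IsSymPower φ (2 * m) (B.summand φ m) ∧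
      (∀ W : Submodule k g, IsSymPower φ (2 * m) W → W = B.summand φ m) ∧
      ∃ W : Submodule k g, IsSl2Stable φ W ∧ IsCompl (B.summand φ m) W) ∧
    ((ℓ = 0 ∨ h ≤ ℓ) → ∀ m ∈ E,
      Module.finrank k (B.centralizerEigenspace m) = 1 ∧
      Module.finrank k ↥(B.summand φ m ⊓ B.negSimpleSpace) = 1) := by
  have h2 := D.two_lt
  refine ⟨fun hℓ m hm => ?_, fun hℓ m hm => ?_⟩
  · have hu' := hu (by omega)
    exact ⟨isSymPower_summand ℓ D hφ hu' hℓ hm,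
      fun W hW => eq_summand_of_isSymPower ℓ D hφ hu' hℓ hm hW,
      B.exists_isCompl_summand ℓ D hφ hu' hℓ hm⟩
  · exact ⟨B.finrank_centralizerEigenspace ℓ D hφ (hu hℓ) hℓ hm,
      B.finrank_summand_inf_negSimpleSpace ℓ D hφ (hu hℓ) hℓ hm⟩

theorem proj_nonzero (D : PrincipalDatum A E h c U l) (hφ : B.IsPrincipal φ)
    (hu : ℓ = 0 ∨ h ≤ ℓ → EigenvectorsDetermined A E c l k) {S : Finset ℕ}
    (hS : ∀ p ∈ S, p.Prime) (hSh : ∀ p < h, p.Prime → p ∈ S) (hℓ : ℓ ∉ S) {m : ℕ} (hm : m ∈ E)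
    {i : Fin n} (hU : U m i ∣ ((∏ p ∈ S, p : ℕ) : ℤ) ^ 20) :
    B.ProjNegRootNonzero (B.summand φ m ⊓ B.negSimpleSpace) i ∧
      B.ProjCorootNonzero (B.summand φ m ⊓ B.cartanSpace) i := by
  have hℓ' := zero_or_le_of_notMem ℓ k hSh hℓ
  have h1 : (U m i : k) ≠ 0 := intCast_ne_zero_of_dvd_prod ℓ hS hℓ hU
  exact ⟨(B.projNegRootNonzero_iff ℓ D hφ (hu hℓ') hℓ' hm i).mpr h1,
    B.projCorootNonzero ℓ D hφ (hu hℓ') hℓ' hm i h1⟩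

theorem exists_proj_zero (D : PrincipalDatum A E h c U l) (hφ : B.IsPrincipal φ)
    (hu : ℓ = 0 ∨ h ≤ ℓ → EigenvectorsDetermined A E c l k) {S : Finset ℕ}
    (hU : ∀ p ∈ S, h ≤ p → ∃ m ∈ E, ∃ i, (p : ℤ) ∣ U m i) (hℓ : ℓ ∈ S) (hhℓ : h ≤ ℓ) :
    ∃ m ∈ E, ∃ i, ¬ B.ProjNegRootNonzero (B.summand φ m ⊓ B.negSimpleSpace) i := by
  obtain ⟨m, hm, i, hi⟩ := hU ℓ hℓ hhℓ
  refine ⟨m, hm, i, ?_⟩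
  rw [B.projNegRootNonzero_iff ℓ D hφ (hu (.inr hhℓ)) (.inr hhℓ) hm, not_not,
    CharP.intCast_eq_zero_iff k ℓ]
  exact hi

end ChevalleyBasis

/-! ### The data of the exceptional types -/

namespace ExceptionalType

/-- The coefficients of `2ρ^∨`. -/
def twoRhoCoeff : (t : ExceptionalType) → Fin t.rank → ℤ
  | G₂ => ![10, 6]
  | F₄ => ![22, 42, 30, 16]
  | E₆ => ![16, 22, 30, 42, 30, 16]
  | E₇ => ![34, 49, 66, 96, 75, 52, 27]
  | E₈ => ![92, 136, 182, 270, 220, 168, 114, 58]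

/-- For each exponent `m`, the coordinates of a vector of the Cartan subalgebra that spans its
intersection with `V_m`. -/
def eigenCoeff : (t : ExceptionalType) → ℕ → Fin t.rank → ℤ
  | G₂, 1 => ![5, 3]
  | G₂, 5 => ![-3, 1]
  | F₄, 1 => ![11, 21, 15, 8]
  | F₄, 5 => ![-11, -7, 1, 8]
  | F₄, 7 => ![22, -12, -15, 10]
  | F₄, 11 => ![-14, 56, -25, 4]
  | E₆, 1 => ![8, 11, 15, 21, 15, 8]
  | E₆, 4 => ![-4, 0, -3, 0, 3, 4]
  | E₆, 5 => ![8, -11, 1, -7, 1, 8]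
  | E₆, 7 => ![10, 22, -15, -12, -15, 10]
  | E₆, 8 => ![-2, 0, 5, 0, -5, 2]
  | E₆, 11 => ![4, -14, -25, 56, -25, 4]
  | E₇, 1 => ![34, 49, 66, 96, 75, 52, 27]
  | E₇, 5 => ![-374, -196, -418, -272, 155, 520, 585]
  | E₇, 7 => ![748, -518, 264, -444, -375, -26, 351]
  | E₇, 9 => ![-34, 294, 22, 48, -265, -260, 195]
  | E₇, 11 => ![-136, -196, 256, 136, 25, -130, 45]
  | E₇, 13 => ![187, -168, -627, 288, 825, -640, 135]
  | E₇, 17 => ![-143, 588, 1001, -2496, 1375, -364, 39]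
  | E₈, 1 => ![46, 68, 91, 135, 110, 84, 57, 29]
  | E₈, 7 => ![-299, -255, -416, -405, -55, 309, 570, 551]
  | E₈, 11 => ![5635, -1530, 3185, -1575, -4035, -4074, -912, 3306]
  | E₈, 13 => ![-690, 1020, -15, 675, -110, -804, -627, 551]
  | E₈, 17 => ![-4186, -23820, 5551, 5955, 23430, 8316, -21945, 6699]
  | E₈, 19 => ![299, 306, -637, -243, 187, 294, -264, 58]
  | E₈, 23 => ![-1911, 2907, 7644, -5985, -10285, 11221, -4142, 551]
  | E₈, 29 => ![7774, -34884, -57967, 153387, -94622, 31556, -5681, 437]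
  | _, _ => 0

/-- The node at the end of the longest branch of the Dynkin diagram. -/
def lastNode : (t : ExceptionalType) → Fin t.rank
  | G₂ => (1 : Fin 2) | F₄ => (3 : Fin 4) | E₆ => (5 : Fin 6) | E₇ => (6 : Fin 7)
  | E₈ => (7 : Fin 8)

theorem det_cartan_dvd (t : ExceptionalType) :
    t.cartan.det ∣ (((t.coxeterNumber - 1).factorial : ℕ) : ℤ) ^ 20 := by
  cases t
  · exact (CartanMatrix.G₂_det : (cartan .G₂).det = 1) ▸ one_dvd _
  · exact (CartanMatrix.F₄_det : (cartan .F₄).det = 1) ▸ one_dvd _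
  · exact (CartanMatrix.E₆_det : (cartan .E₆).det = 3) ▸ by decide +kernel
  · exact (CartanMatrix.E₇_det : (cartan .E₇).det = 2) ▸ by decide +kernel
  · exact (CartanMatrix.E₈_det : (cartan .E₈).det = 1) ▸ one_dvd _

theorem exists_positiveRootCodes (t : ExceptionalType) : ∃ o L,
    IsPositiveRootCodes t.cartan o L ∧ HeightBound t.rank t.coxeterNumber t.exponents L := by
  cases t
  · exact ⟨_, _, isPositiveRootCodes_G₂, heightBound_G₂⟩
  · exact ⟨_, _, isPositiveRootCodes_F₄, heightBound_F₄⟩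
  · exact ⟨_, _, isPositiveRootCodes_E₆, heightBound_E₆⟩
  · exact ⟨_, _, isPositiveRootCodes_E₇, heightBound_E₇⟩
  · exact ⟨_, _, isPositiveRootCodes_E₈, heightBound_E₈⟩

theorem principalDatum (t : ExceptionalType) :
    PrincipalDatum t.cartan t.exponents t.coxeterNumber t.twoRhoCoeff t.eigenCoeff t.lastNode where
  exists_codes := t.exists_positiveRootCodes
  sum_mul_c := by cases t <;> decide +kernel
  eigen := by cases t <;> decide +kernel
  card := by cases t <;> rfl
  two_lt := by cases t <;> decide
  pos_lt := by cases t <;> decide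
  det_dvd := t.det_cartan_dvd
  last_dvd := by cases t <;> decide +kernel
  casimir_dvd := by cases t <;> decide +kernel
  eigenvalue_dvd := by cases t <;> decide +kernel
  diff_dvd := by cases t <;> decide +kernel

theorem prime_of_mem_badPrimes (t : ExceptionalType) : ∀ p ∈ t.badPrimes, p.Prime := by
  cases t <;> simp only [badPrimes, Finset.mem_insert, Finset.mem_singleton, forall_eq_or_imp,
    forall_eq] <;> norm_num

theorem mem_badPrimes_of_lt (t : ExceptionalType) :
    ∀ p < t.coxeterNumber, p.Prime → p ∈ t.badPrimes := by
  cases t <;> decide +kernel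

theorem exists_dvd_eigenCoeff (t : ExceptionalType) : ∀ p ∈ t.badPrimes, t.coxeterNumber ≤ p →
    ∃ m ∈ t.exponents, ∃ i, (p : ℤ) ∣ t.eigenCoeff m i := by
  cases t <;> decide +kernel

/-- The excluded entries are zero in `E₆`: the eigenvectors for 4 and 8 change sign under the
diagram automorphism, which fixes nodes 1 and 3. No other type has 4 or 8 as an exponent. -/
theorem eigenCoeff_dvd (t : ExceptionalType) : ∀ m ∈ t.exponents,
    ∀ i : Fin t.rank, (m ≠ 4 ∧ m ≠ 8) ∨ (i.val ≠ 1 ∧ i.val ≠ 3) →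
      t.eigenCoeff m i ∣ ((∏ p ∈ t.badPrimes, p : ℕ) : ℤ) ^ 20 := by
  cases t <;> decide +kernel

end ExceptionalType

/-! ### Eigenvectors are determined by one coordinate; the diagram automorphism of `E₆` -/

namespace ExceptionalType

variable {k : Type*} [Field k] (ℓ : ℕ) [CharP k ℓ]

/-- Here and for `F₄` the diagram is a chain. If a coordinate and those beyond it towards the last
node vanish, the equation at that node forces the next one to vanish, as `c_i` and the entries of
`A` on adjacent nodes are invertible in `k`. -/
theorem eigenvectorsDetermined_G₂ (hℓ : ℓ = 0 ∨ 6 ≤ ℓ) :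
    EigenvectorsDetermined CartanMatrix.G₂ (exponents .G₂) (twoRhoCoeff .G₂) (lastNode .G₂) k := by
  intro m _ x hx h1
  have hn : ∀ a : ℤ, a ∣ ((Nat.factorial 5 : ℕ) : ℤ) ^ 20 → (a : k) ≠ 0 := fun a ha =>
    intCast_ne_zero_of_dvd_factorial ℓ (by omega) ha
  replace h1 : x 1 = 0 := h1
  have c1' : (6 : k) ≠ 0 := by exact_mod_cast hn 6 (by decide +kernel)
  have h0 : x 0 = 0 := by
    simpa [cartanEnd_apply, Fin.sum_univ_succ, CartanMatrix.G₂, twoRhoCoeff, h1, c1'] using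
      congrFun hx 1
  funext i
  fin_cases i <;> assumption

theorem eigenvectorsDetermined_F₄ (hℓ : ℓ = 0 ∨ 12 ≤ ℓ) :
    EigenvectorsDetermined CartanMatrix.F₄ (exponents .F₄) (twoRhoCoeff .F₄) (lastNode .F₄) k := by
  intro m _ x hx h3
  have hn : ∀ a : ℤ, a ∣ ((Nat.factorial 11 : ℕ) : ℤ) ^ 20 → (a : k) ≠ 0 := fun a ha =>
    intCast_ne_zero_of_dvd_factorial ℓ (by omega) ha
  replace h3 : x 3 = 0 := h3
  have c3' : (16 : k) ≠ 0 := by exact_mod_cast hn 16 (by decide +kernel)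
  have h2 : x 2 = 0 := by
    simpa [cartanEnd_apply, Fin.sum_univ_succ, CartanMatrix.F₄, twoRhoCoeff, h3, c3'] using
      congrFun hx 3
  have c2' : (30 : k) ≠ 0 := by exact_mod_cast hn 30 (by decide +kernel)
  have h1 : x 1 = 0 := by
    simpa [cartanEnd_apply, Fin.sum_univ_succ, CartanMatrix.F₄, twoRhoCoeff, h2, h3, c2'] using
      congrFun hx 2
  have c1' : (42 : k) ≠ 0 := by exact_mod_cast hn 42 (by decide +kernel)
  have h0 : x 0 = 0 := by
    simpa [cartanEnd_apply, Fin.sum_univ_succ, CartanMatrix.F₄, twoRhoCoeff, h1, h2, c1'] using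
      congrFun hx 1
  funext i
  fin_cases i <;> assumption

/-- In type `E` the vanishing moves along the long branch up to the branch node 3. There two
coordinates are still unknown, so node 1, a leaf attached to node 3, is treated first by its own
equation. -/
theorem eigenvectorsDetermined_E₆ (hℓ : ℓ = 0 ∨ 12 ≤ ℓ) :
    EigenvectorsDetermined CartanMatrix.E₆ (exponents .E₆) (twoRhoCoeff .E₆) (lastNode .E₆) k := by
  intro m hm x hx h5
  have hn : ∀ a : ℤ, a ∣ ((Nat.factorial 11 : ℕ) : ℤ) ^ 20 → (a : k) ≠ 0 := fun a ha =>
    intCast_ne_zero_of_dvd_factorial ℓ (by omega) ha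
  replace h5 : x 5 = 0 := h5
  have c5' : (16 : k) ≠ 0 := by exact_mod_cast hn 16 (by decide +kernel)
  have h4 : x 4 = 0 := by
    simpa [cartanEnd_apply, Fin.sum_univ_succ, CartanMatrix.E₆, twoRhoCoeff, h5, c5'] using
      congrFun hx 5
  have c4' : (30 : k) ≠ 0 := by exact_mod_cast hn 30 (by decide +kernel)
  have h3 : x 3 = 0 := by
    simpa [cartanEnd_apply, Fin.sum_univ_succ, CartanMatrix.E₆, twoRhoCoeff, h4, h5, c4'] using
      congrFun hx 4
  -- With `x 3 = 0`, the equation at the leaf 1 reads `2 c_1 x_1 = m (m + 1) x_1`, and `2 c_1 = 44`.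
  have c1 : ((m : k) * (m + 1) - 44) ≠ 0 := by
    have h1 : ∀ m ∈ exponents .E₆, ((m : ℤ) * (m + 1) - 44) ∣
        ((Nat.factorial 11 : ℕ) : ℤ) ^ 20 := by decide +kernel
    exact_mod_cast hn _ (h1 m hm)
  have h1 : x 1 = 0 := by
    have e1 := congrFun hx 1
    simp [cartanEnd_apply, Fin.sum_univ_succ, CartanMatrix.E₆, twoRhoCoeff, h3] at e1
    refine (mul_eq_zero.mp ?_).resolve_left c1
    linear_combination -e1
  have c3' : (42 : k) ≠ 0 := by exact_mod_cast hn 42 (by decide +kernel)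
  have h2 : x 2 = 0 := by
    simpa [cartanEnd_apply, Fin.sum_univ_succ, CartanMatrix.E₆, twoRhoCoeff, h1, h3, h4, c3'] using
      congrFun hx 3
  have c2' : (30 : k) ≠ 0 := by exact_mod_cast hn 30 (by decide +kernel)
  have h0 : x 0 = 0 := by
    simpa [cartanEnd_apply, Fin.sum_univ_succ, CartanMatrix.E₆, twoRhoCoeff, h2, h3, c2'] using
      congrFun hx 2
  funext i
  fin_cases i <;> assumption

theorem eigenvectorsDetermined_E₇ (hℓ : ℓ = 0 ∨ 18 ≤ ℓ) :
    EigenvectorsDetermined CartanMatrix.E₇ (exponents .E₇) (twoRhoCoeff .E₇) (lastNode .E₇) k := by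
  intro m hm x hx h6
  have hn : ∀ a : ℤ, a ∣ ((Nat.factorial 17 : ℕ) : ℤ) ^ 20 → (a : k) ≠ 0 := fun a ha =>
    intCast_ne_zero_of_dvd_factorial ℓ (by omega) ha
  replace h6 : x 6 = 0 := h6
  have c6' : (27 : k) ≠ 0 := by exact_mod_cast hn 27 (by decide +kernel)
  have h5 : x 5 = 0 := by
    simpa [cartanEnd_apply, Fin.sum_univ_succ, CartanMatrix.E₇, twoRhoCoeff, h6, c6'] using
      congrFun hx 6
  have c5' : (52 : k) ≠ 0 := by exact_mod_cast hn 52 (by decide +kernel)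
  have h4 : x 4 = 0 := by
    simpa [cartanEnd_apply, Fin.sum_univ_succ, CartanMatrix.E₇, twoRhoCoeff, h5, h6, c5'] using
      congrFun hx 5
  have c4' : (75 : k) ≠ 0 := by exact_mod_cast hn 75 (by decide +kernel)
  have h3 : x 3 = 0 := by
    simpa [cartanEnd_apply, Fin.sum_univ_succ, CartanMatrix.E₇, twoRhoCoeff, h4, h5, c4'] using
      congrFun hx 4
  -- As in `E₆`, now with `2 c_1 = 98`.
  have c1 : ((m : k) * (m + 1) - 98) ≠ 0 := by
    have h1 : ∀ m ∈ exponents .E₇, ((m : ℤ) * (m + 1) - 98) ∣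
        ((Nat.factorial 17 : ℕ) : ℤ) ^ 20 := by decide +kernel
    exact_mod_cast hn _ (h1 m hm)
  have h1 : x 1 = 0 := by
    have e1 := congrFun hx 1
    simp [cartanEnd_apply, Fin.sum_univ_succ, CartanMatrix.E₇, twoRhoCoeff, h3] at e1
    refine (mul_eq_zero.mp ?_).resolve_left c1
    linear_combination -e1
  have c3' : (96 : k) ≠ 0 := by exact_mod_cast hn 96 (by decide +kernel)
  have h2 : x 2 = 0 := by
    simpa [cartanEnd_apply, Fin.sum_univ_succ, CartanMatrix.E₇, twoRhoCoeff, h1, h3, h4, c3'] using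
      congrFun hx 3
  have c2' : (66 : k) ≠ 0 := by exact_mod_cast hn 66 (by decide +kernel)
  have h0 : x 0 = 0 := by
    simpa [cartanEnd_apply, Fin.sum_univ_succ, CartanMatrix.E₇, twoRhoCoeff, h2, h3, c2'] using
      congrFun hx 2
  funext i
  fin_cases i <;> assumption

theorem eigenvectorsDetermined_E₈ (hℓ : ℓ = 0 ∨ 30 ≤ ℓ) :
    EigenvectorsDetermined CartanMatrix.E₈ (exponents .E₈) (twoRhoCoeff .E₈) (lastNode .E₈) k := by
  intro m hm x hx h7
  have hn : ∀ a : ℤ, a ∣ ((Nat.factorial 29 : ℕ) : ℤ) ^ 20 → (a : k) ≠ 0 := fun a ha =>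
    intCast_ne_zero_of_dvd_factorial ℓ (by omega) ha
  replace h7 : x 7 = 0 := h7
  have c7' : (58 : k) ≠ 0 := by exact_mod_cast hn 58 (by decide +kernel)
  have h6 : x 6 = 0 := by
    simpa [cartanEnd_apply, Fin.sum_univ_succ, CartanMatrix.E₈, twoRhoCoeff, h7, c7'] using
      congrFun hx 7
  have c6' : (114 : k) ≠ 0 := by exact_mod_cast hn 114 (by decide +kernel)
  have h5 : x 5 = 0 := by
    simpa [cartanEnd_apply, Fin.sum_univ_succ, CartanMatrix.E₈, twoRhoCoeff, h6, h7, c6'] using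
      congrFun hx 6
  have c5' : (168 : k) ≠ 0 := by exact_mod_cast hn 168 (by decide +kernel)
  have h4 : x 4 = 0 := by
    simpa [cartanEnd_apply, Fin.sum_univ_succ, CartanMatrix.E₈, twoRhoCoeff, h5, h6, c5'] using
      congrFun hx 5
  have c4' : (220 : k) ≠ 0 := by exact_mod_cast hn 220 (by decide +kernel)
  have h3 : x 3 = 0 := by
    simpa [cartanEnd_apply, Fin.sum_univ_succ, CartanMatrix.E₈, twoRhoCoeff, h4, h5, c4'] using
      congrFun hx 4
  -- As in `E₆`, now with `2 c_1 = 272`.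
  have c1 : ((m : k) * (m + 1) - 272) ≠ 0 := by
    have h1 : ∀ m ∈ exponents .E₈, ((m : ℤ) * (m + 1) - 272) ∣
        ((Nat.factorial 29 : ℕ) : ℤ) ^ 20 := by decide +kernel
    exact_mod_cast hn _ (h1 m hm)
  have h1 : x 1 = 0 := by
    have e1 := congrFun hx 1
    simp [cartanEnd_apply, Fin.sum_univ_succ, CartanMatrix.E₈, twoRhoCoeff, h3] at e1
    refine (mul_eq_zero.mp ?_).resolve_left c1
    linear_combination -e1
  have c3' : (270 : k) ≠ 0 := by exact_mod_cast hn 270 (by decide +kernel)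
  have h2 : x 2 = 0 := by
    simpa [cartanEnd_apply, Fin.sum_univ_succ, CartanMatrix.E₈, twoRhoCoeff, h1, h3, h4, c3'] using
      congrFun hx 3
  have c2' : (182 : k) ≠ 0 := by exact_mod_cast hn 182 (by decide +kernel)
  have h0 : x 0 = 0 := by
    simpa [cartanEnd_apply, Fin.sum_univ_succ, CartanMatrix.E₈, twoRhoCoeff, h2, h3, c2'] using
      congrFun hx 2
  funext i
  fin_cases i <;> assumption

theorem eigenvectorsDetermined (t : ExceptionalType) (hℓ : ℓ = 0 ∨ t.coxeterNumber ≤ ℓ) :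
    EigenvectorsDetermined t.cartan t.exponents t.twoRhoCoeff t.lastNode k := by
  cases t
  · exact eigenvectorsDetermined_G₂ ℓ hℓ
  · exact eigenvectorsDetermined_F₄ ℓ hℓ
  · exact eigenvectorsDetermined_E₆ ℓ hℓ
  · exact eigenvectorsDetermined_E₇ ℓ hℓ
  · exact eigenvectorsDetermined_E₈ ℓ hℓ

theorem exists_isMoved_E₆ : ∃ i, IsMoved .E₆ i := by
  let σ : Equiv.Perm (Fin 6) := Equiv.swap 0 5 * Equiv.swap 2 4
  have h1 : CartanMatrix.E₆.submatrix (Equiv.swap 0 5 * Equiv.swap 2 4 : Equiv.Perm (Fin 6))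
      (Equiv.swap 0 5 * Equiv.swap 2 4 : Equiv.Perm (Fin 6)) = CartanMatrix.E₆ := by
    decide +kernel
  have h2 : σ 0 ≠ 0 := by decide +kernel
  exact ⟨(0 : Fin 6), σ, fun a b => congrFun (congrFun h1 a) b, h2⟩

/-- An automorphism of the Dynkin diagram `E₆` fixes the branch node and its neighbour of degree
`1`. -/
theorem perm_fixes_E₆ (σ : Equiv.Perm (Fin 6))
    (hσ : ∀ a b : Fin 6, CartanMatrix.E₆ (σ a) (σ b) = CartanMatrix.E₆ a b) :
    σ 1 = 1 ∧ σ 3 = 3 := by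
  -- A row sum of the Cartan matrix is 2 minus the degree of the node: the branch node is the only
  -- one with sum `-1`, and node 1 is the only leaf adjacent to it.
  have hsum : ∀ a : Fin 6, ∑ b, CartanMatrix.E₆ (σ a) b = ∑ b, CartanMatrix.E₆ a b := fun a => by
    rw [← Equiv.sum_comp σ]
    exact Finset.sum_congr rfl fun b _ => hσ a b
  have h3 : σ 3 = 3 := by
    have h : ∀ j : Fin 6, ∑ b, CartanMatrix.E₆ j b = ∑ b, CartanMatrix.E₆ 3 b → j = 3 := by
      decide +kernel
    exact h _ (hsum 3)
  refine ⟨?_, h3⟩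
  have h : ∀ j : Fin 6, ∑ b, CartanMatrix.E₆ j b = ∑ b, CartanMatrix.E₆ 1 b →
      CartanMatrix.E₆ j 3 = CartanMatrix.E₆ 1 3 → j = 1 := by
    decide +kernel
  refine h _ (hsum 1) ?_
  have := hσ 1 3
  rwa [h3] at this

theorem ne_of_isMoved_E₆ {i : Fin 6} (hi : IsMoved .E₆ i) : i.val ≠ 1 ∧ i.val ≠ 3 := by
  obtain ⟨σ, hσ, hne⟩ := hi
  obtain ⟨h1, h3⟩ := perm_fixes_E₆ σ hσ
  constructor
  · rintro h
    obtain rfl : i = 1 := Fin.ext h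
    exact hne h1
  · rintro h
    obtain rfl : i = 3 := Fin.ext h
    exact hne h3

theorem ne_of_mem_exponents (t : ExceptionalType) (ht : t ≠ .E₆) :
    ∀ m ∈ t.exponents, m ≠ 4 ∧ m ≠ 8 := by
  cases t
  · decide
  · decide
  · exact absurd rfl ht
  · decide
  · decide

end ExceptionalType

theorem mainTheorem12 (t : ExceptionalType) {k g : Type*} [Field k] (ℓ : ℕ) [CharP k ℓ]
    [LieRing g] [LieAlgebra k g] (B : ChevalleyBasis t.cartan k g)
    (φ : LieAlgebra.SpecialLinear.sl (Fin 2) k →ₗ⁅k⁆ g) (hφ : B.IsPrincipal φ) :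
    -- For `ℓ = 0` or `ℓ ≥ 2h - 1`, `V_m` is the unique `sl₂`-submodule isomorphic to `Sym^{2m}(k²)`,
    -- and it is a direct summand.
    ((ℓ = 0 ∨ 2 * t.coxeterNumber - 1 ≤ ℓ) → ∀ m ∈ t.exponents,
      IsSymPower φ (2 * m) (B.summand φ m) ∧
      (∀ W : Submodule k g, IsSymPower φ (2 * m) W → W = B.summand φ m) ∧
      ∃ W : Submodule k g, IsSl2Stable φ W ∧ IsCompl (B.summand φ m) W) ∧
    -- For `ℓ = 0` or `ℓ ≥ h`, `P_{2m}` is a line, and `V_m` contains a unique line in the sum of the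
    -- negative simple root spaces.
    ((ℓ = 0 ∨ t.coxeterNumber ≤ ℓ) → ∀ m ∈ t.exponents,
      Module.finrank k (B.centralizerEigenspace m) = 1 ∧
      Module.finrank k ↥(B.summand φ m ⊓ B.negSimpleSpace) = 1) ∧
    -- Types `G₂, F₄, E₇, E₈`, primes that are not listed.
    (t ≠ .E₆ → ℓ ∉ t.badPrimes → ∀ m ∈ t.exponents, ∀ i,
      B.ProjNegRootNonzero (B.summand φ m ⊓ B.negSimpleSpace) i) ∧
    -- Listed primes `ℓ ≥ h` are exceptions.
    (ℓ ∈ t.badPrimes → t.coxeterNumber ≤ ℓ → ∃ m ∈ t.exponents, ∃ i,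
      ¬ B.ProjNegRootNonzero (B.summand φ m ⊓ B.negSimpleSpace) i) ∧
    -- Type `E₆`.
    (t = .E₆ → ℓ ∉ t.badPrimes →
      (∀ m ∈ t.exponents, m ≠ 4 → m ≠ 8 → ∀ i,
        B.ProjNegRootNonzero (B.summand φ m ⊓ B.negSimpleSpace) i) ∧
      (∃ i, t.IsMoved i) ∧
      ∀ i, t.IsMoved i →
        (∀ m ∈ ({4, 8} : Finset ℕ),
          B.ProjNegRootNonzero (B.summand φ m ⊓ B.negSimpleSpace) i) ∧
        ∀ m ∈ t.exponents,
          B.ProjCorootNonzero (B.summand φ m ⊓ B.cartanSpace) i) := by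
  have D := t.principalDatum
  have hu := t.eigenvectorsDetermined (k := k) ℓ
  have hproj : ℓ ∉ t.badPrimes → ∀ m ∈ t.exponents, ∀ i : Fin t.rank,
      (m ≠ 4 ∧ m ≠ 8) ∨ (i.val ≠ 1 ∧ i.val ≠ 3) →
      B.ProjNegRootNonzero (B.summand φ m ⊓ B.negSimpleSpace) i ∧
        B.ProjCorootNonzero (B.summand φ m ⊓ B.cartanSpace) i := fun hℓ m hm i hi =>
    ChevalleyBasis.proj_nonzero ℓ D hφ hu t.prime_of_mem_badPrimes t.mem_badPrimes_of_lt hℓ hm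
      (t.eigenCoeff_dvd m hm i hi)
  obtain ⟨h1, h2⟩ := ChevalleyBasis.symPower_and_lines ℓ D hφ hu
  refine ⟨h1, h2, fun ht hℓ m hm i => (hproj hℓ m hm i (.inl (t.ne_of_mem_exponents ht m hm))).1,
    fun hℓ hhℓ => ChevalleyBasis.exists_proj_zero ℓ D hφ hu t.exists_dvd_eigenCoeff hℓ hhℓ, ?_⟩
  rintro rfl hℓ
  refine ⟨fun m hm h4 h8 i => (hproj hℓ m hm i (.inl ⟨h4, h8⟩)).1,
    ExceptionalType.exists_isMoved_E₆, fun i hi => ?_⟩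
  have hi' := ExceptionalType.ne_of_isMoved_E₆ hi
  refine ⟨fun m hm => (hproj hℓ m ?_ i (.inr hi')).1, fun m hm => (hproj hℓ m hm i (.inr hi')).2⟩
  revert m
  decide
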